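/- Let $1\le p\le 5$. Let $H^1(\mathbb R^3)$ be the real Sobolev space with norm $\|u\|^2=\int_{\mathbb R^3}|\nabla u|^2+u^2$, and let $$\mathcal X=D^{1,2}(\mathbb R^3)\cap\{\phi\in C^{0,1}(\mathbb R^3):\ \|\nabla\phi\|_\infty\le 1\},$$ where $D^{1,2}(\mathbb R^3)$ is the completion of $C_c^\infty(\mathbb R^3)$ with respect to the norm $\|\nabla\cdot\|_{L^2}$ (realized as a space of functions in $L^6(\mathbb R^3)$). For $u\in H^1(\mathbb R^3)$ and $\phi\in\mathcal X$ put $$E(u,\phi)=\int_{\mathbb R^3}\Bigl(1-\sqrt{1-|\nabla\phi|^2}\Bigr)-\int_{\mathbb R^3}\phi u^2,$$ $$F(u,\phi)=\frac12\int_{\mathbb R^3}\bigl(|\nabla u|^2+u^2\bigr)+\frac12\int_{\mathbb R^3}\phi u^2-\frac1{p+1}\int_{\mathbb R^3}|u|^{p+1}-\frac12\int_{\mathbb R^3}\Bigl(1-\sqrt{1-|\nabla\phi|^2}\Bigr).$$ All these integrals are finite. For every $u\in H^1(\mathbb R^3)$ the functional $E(u,\cdot)$ has a unique minimizer $\phi_u$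 on $\mathcal X$. The reduced functional $I(u)=F(u,\phi_u)$ is of class $C^1$ on $H^1(\mathbb R^3)$, and for all $u,v\in H^1(\mathbb R^3)$ $$I'(u)[v]=\int_{\mathbb R^3}\nabla u\cdot\nabla v+\int_{\mathbb R^3}uv+\int_{\mathbb R^3}\phi_u uv-\int_{\mathbb R^3}|u|^{p-1}uv,$$ where the four integrands are integrable. -/

import Mathlib

open MeasureTheory Filter
open scoped Topology ContDiff Gradient

namespace BornInfeld

/-- Three-dimensional Euclidean space, with its Euclidean norm and Lebesgue measure. -/
abbrev R3 : Type := EuclideanSpace ℝ (Fin 3)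

/-- Test functions: smooth real functions with compact support. -/
def IsTest (ψ : R3 → ℝ) : Prop := ContDiff ℝ ∞ ψ ∧ HasCompactSupport ψ

/-- `G` is the weak (distributional) gradient of `f`. The identity is between vectors
of `R3`, so it contains the three weak partial derivatives. -/
def HasWeakGradient (f : R3 → ℝ) (G : R3 → R3) : Prop :=
  ∀ ψ : R3 → ℝ, IsTest ψ → ∫ x, f x • ∇ ψ x = -∫ x, ψ x • G x

theorem IsTest.continuous_gradient {ψ : R3 → ℝ} (h : IsTest ψ) : Continuous (∇ ψ) :=
  (InnerProductSpace.toDual ℝ R3).symm.continuous.comp (h.1.continuous_fderiv (by simp))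

theorem IsTest.hasCompactSupport_gradient {ψ : R3 → ℝ} (h : IsTest ψ) :
    HasCompactSupport (∇ ψ) :=
  (h.2.fderiv ℝ).comp_left (g := (InnerProductSpace.toDual ℝ R3).symm) (map_zero _)

theorem IsTest.integrable_smul_gradient {ψ : R3 → ℝ} (h : IsTest ψ)
    (f : Lp ℝ 2 (volume : Measure R3)) : Integrable (fun x => f x • ∇ ψ x) :=
  memLp_one_iff_integrable.1 <| MemLp.smul (p := 2) (q := 2) (r := 1)
    (h.continuous_gradient.memLp_of_hasCompactSupport h.hasCompactSupport_gradient) (Lp.memLp f)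

theorem IsTest.integrable_smul {ψ : R3 → ℝ} (h : IsTest ψ)
    (G : Lp R3 2 (volume : Measure R3)) : Integrable (fun x => ψ x • G x) :=
  memLp_one_iff_integrable.1 <| MemLp.smul (p := 2) (q := 2) (r := 1)
    (Lp.memLp G) (h.1.continuous.memLp_of_hasCompactSupport h.2)

/-- The real Sobolev space `H¹(ℝ³)`, as the space of pairs `(u, ∇u)` of an `L²` function and
its weak gradient in `L²`. The norm is inherited from the Hilbert sum of the two `L²` spaces:
`‖u‖² = ∫ u² + ∫ |∇u|²`. -/
def H1 : Submodule ℝ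
    (WithLp 2 (Lp ℝ 2 (volume : Measure R3) × Lp R3 2 (volume : Measure R3))) where
  carrier := {w | HasWeakGradient w.fst w.snd}
  zero_mem' := by
    intro ψ _
    have h1 : (fun x => (((0 : Lp ℝ 2 (volume : Measure R3)) x) • ∇ ψ x : R3))
        =ᵐ[volume] fun _ => 0 := by
      filter_upwards [Lp.coeFn_zero ℝ 2 (volume : Measure R3)] with x hx
      simp
    have h2 : (fun x => (ψ x • ((0 : Lp R3 2 (volume : Measure R3)) x) : R3))
        =ᵐ[volume] fun _ => 0 := by
      filter_upwards [Lp.coeFn_zero R3 2 (volume : Measure R3)] with x hx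
      simp
    change ∫ x, ((0 : Lp ℝ 2 (volume : Measure R3)) x) • ∇ ψ x
      = -∫ x, ψ x • ((0 : Lp R3 2 (volume : Measure R3)) x)
    rw [integral_congr_ae h1, integral_congr_ae h2]
    simp
  add_mem' := by
    intro a b ha hb ψ hψ
    have h1 : (fun x => ((a.fst + b.fst : Lp ℝ 2 (volume : Measure R3)) x) • ∇ ψ x)
        =ᵐ[volume] fun x => a.fst x • ∇ ψ x + b.fst x • ∇ ψ x := by
      filter_upwards [Lp.coeFn_add a.fst b.fst] with x hx
      simp only [hx, Pi.add_apply, add_smul]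
    have h2 : (fun x => ψ x • ((a.snd + b.snd : Lp R3 2 (volume : Measure R3)) x))
        =ᵐ[volume] fun x => ψ x • a.snd x + ψ x • b.snd x := by
      filter_upwards [Lp.coeFn_add a.snd b.snd] with x hx
      simp only [hx, Pi.add_apply, smul_add]
    change ∫ x, ((a.fst + b.fst : Lp ℝ 2 (volume : Measure R3)) x) • ∇ ψ x
      = -∫ x, ψ x • ((a.snd + b.snd : Lp R3 2 (volume : Measure R3)) x)
    rw [integral_congr_ae h1, integral_congr_ae h2,
      integral_add (hψ.integrable_smul_gradient _) (hψ.integrable_smul_gradient _),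
      integral_add (hψ.integrable_smul _) (hψ.integrable_smul _), ha ψ hψ, hb ψ hψ]
    abel
  smul_mem' := by
    intro c a ha ψ hψ
    have h1 : (fun x => ((c • a.fst : Lp ℝ 2 (volume : Measure R3)) x) • ∇ ψ x)
        =ᵐ[volume] fun x => c • (a.fst x • ∇ ψ x) := by
      filter_upwards [Lp.coeFn_smul c a.fst] with x hx
      simp only [hx, Pi.smul_apply, smul_assoc]
    have h2 : (fun x => ψ x • ((c • a.snd : Lp R3 2 (volume : Measure R3)) x))
        =ᵐ[volume] fun x => c • (ψ x • a.snd x) := by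
      filter_upwards [Lp.coeFn_smul c a.snd] with x hx
      simp only [hx, Pi.smul_apply, smul_comm c]
    change ∫ x, ((c • a.fst : Lp ℝ 2 (volume : Measure R3)) x) • ∇ ψ x
      = -∫ x, ψ x • ((c • a.snd : Lp R3 2 (volume : Measure R3)) x)
    rw [integral_congr_ae h1, integral_congr_ae h2, integral_smul, integral_smul, ha ψ hψ,
      smul_neg]

/-- The function underlying an element of `H¹(ℝ³)` (a representative of its `L²` class). -/
noncomputable def H1.fn (u : H1) : R3 → ℝ := u.1.fst

/-- The weak gradient of an element of `H¹(ℝ³)`. -/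
noncomputable def H1.grad (u : H1) : R3 → R3 := u.1.snd

/-- `φ` belongs to `D^{1,2}(ℝ³)`, the completion of the test functions for the norm `‖∇·‖₂`,
realized as a space of functions by the Sobolev embedding into `L⁶`: `φ` is the limit in `L⁶`
of test functions whose gradients converge in `L²`. -/
def MemD12 (φ : R3 → ℝ) : Prop :=
  ∃ (ψ : ℕ → R3 → ℝ) (G : R3 → R3), (∀ n, IsTest (ψ n)) ∧ MemLp G 2 ∧
    Tendsto (fun n => eLpNorm (fun x => ∇ (ψ n) x - G x) 2) atTop (𝓝 0) ∧
    Tendsto (fun n => eLpNorm (fun x => ψ n x - φ x) 6) atTop (𝓝 0)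

/-- The set `𝒳` of the Lipschitz functions in `D^{1,2}(ℝ³)` with `‖∇φ‖_∞ ≤ 1`. The gradient of
a Lipschitz function is its classical gradient, which exists almost everywhere. -/
def X : Set (R3 → ℝ) :=
  {φ | MemD12 φ ∧ (∃ K, LipschitzWith K φ) ∧ ∀ᵐ x, ‖∇ φ x‖ ≤ 1}

/-- `E(u, φ) = ∫ (1 - √(1 - |∇φ|²)) - ∫ φ u²`, for `φ ∈ 𝒳`. -/
noncomputable def E (u : H1) (φ : R3 → ℝ) : ℝ :=
  (∫ x, (1 - √(1 - ‖∇ φ x‖ ^ 2))) - ∫ x, φ x * H1.fn u x ^ 2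

/-- `F(u, φ) = ½ ∫ (|∇u|² + u²) + ½ ∫ φ u² - 1/(p+1) ∫ |u|^{p+1} - ½ ∫ (1 - √(1 - |∇φ|²))`,
for `φ ∈ 𝒳`. -/
noncomputable def F (p : ℝ) (u : H1) (φ : R3 → ℝ) : ℝ :=
  1 / 2 * (∫ x, (‖H1.grad u x‖ ^ 2 + H1.fn u x ^ 2)) + 1 / 2 * (∫ x, φ x * H1.fn u x ^ 2)
    - 1 / (p + 1) * (∫ x, |H1.fn u x| ^ (p + 1)) - 1 / 2 * ∫ x, (1 - √(1 - ‖∇ φ x‖ ^ 2))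

/-- `φ` is a minimizer of `E(u, ·)` on `𝒳`. -/
def IsMinimizer (u : H1) (φ : R3 → ℝ) : Prop :=
  φ ∈ X ∧ ∀ χ ∈ X, E u φ ≤ E u χ

/-- The minimizer `φ_u` of `E(u, ·)` on `𝒳`. Its existence and uniqueness are not part of
this definition and have to be proved. -/
noncomputable def phi (u : H1) : R3 → ℝ := Classical.epsilon (IsMinimizer u)

/-- The reduced functional `I(u) = F(u, φ_u)`. -/
noncomputable def I (p : ℝ) (u : H1) : ℝ := F p u (phi u)

end BornInfeld

open BornInfeld

/-!
The functional `E(u, φ) = ∫ (1 - √(1 - |∇φ|²)) - ∫ φ u²` is uniformly convex in `φ` for the norm of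
`D^{1,2}`: on the unit ball the density `1 - √(1 - |z|²)` minus `½ |z|²` is midpoint convex
(`density_midpoint_le`). Everything about the minimizer follows from this.

*Existence and uniqueness.* By the Sobolev inequality `‖φ‖₆ ≤ S ‖∇φ‖₂` and Hölder's inequality
(`φ ∈ L⁶`, `u ∈ L³ ∩ L²`) the coupling `∫ φ u v` is continuous, so `E(u, ·)` is bounded below. Uniform
convexity makes a minimizing sequence a Cauchy sequence of gradients in `L²`, and the midpoint of two
minimizers shows that they coincide (`exists_action_minimizer`, `action_minimizer_unique`). The limit
stays in `𝒳` (`exists_tendsto_toGrad`): a Lipschitz function with `|∇φ| ≤ 1` almost everywhere is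
`1`-Lipschitz, which is seen on its mollifications (`lipschitzWith_one_of_gradient`), and an almost
everywhere limit of `1`-Lipschitz functions has a `1`-Lipschitz representative. Its `D^{1,2}` gradient
is its classical one by Rademacher's theorem and the uniqueness of weak gradients.

*Differentiability.* The quadratic growth of `E(u, ·)` at its minimizer shows that `φ_u` depends on
`u` in a locally Lipschitz way (`norm_toGrad_minimizer_sub_le`). Comparing with the minimizer of
another point bounds `E(v, φ_v) - E(u, φ_u)` from above by `-2 ∫ φ_u u (v - u)` plus a quadratic
error. A function with such upper bounds, continuous in `u`, is `C¹`, because the exchange of `u` and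
`v` yields the matching lower bound (`contDiff_one_of_le_quadratic`). The same criterion applies to
`-∫ |u|^(p+1)`, by convexity of `|·|^(p+1)` and the local Lipschitz continuity of `|u|^(p-1) u` from
`L^(p+1)` to its dual (`integral_rpow_sub_le`). Finally `I(u) = ½ ‖u‖² - ½ E(u, φ_u) - 1/(p+1) ∫
|u|^(p+1)`.

*Sobolev embedding.* For `u ∈ H¹`, given with its weak gradient, the inequality for test functions is
transferred by cutoffs and mollification (`HasWeakGradient.eLpNorm_six_le`); interpolation between
`L²` and `L⁶` gives `H¹ → L^q` for `2 ≤ q ≤ 6`.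
-/

namespace BornInfeld

open scoped Convolution NNReal ENNReal

/-! ### Weak gradients and mollification -/

theorem norm_gradient (f : R3 → ℝ) (x : R3) : ‖∇ f x‖ = ‖fderiv ℝ f x‖ := by
  simp [gradient]

theorem inner_gradient (f : R3 → ℝ) (x v : R3) : inner ℝ (∇ f x) v = fderiv ℝ f x v := by
  simp [gradient, InnerProductSpace.toDual_symm_apply]

theorem measurable_gradient (f : R3 → ℝ) : Measurable (∇ f) :=
  (InnerProductSpace.toDual ℝ R3).symm.continuous.measurable.comp (measurable_fderiv ℝ f)

theorem IsTest.comp_const_sub {ρ : R3 → ℝ} (h : IsTest ρ) (x : R3) :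
    IsTest (fun t => ρ (x - t)) :=
  ⟨h.1.comp (contDiff_const.sub contDiff_id), h.2.comp_homeomorph (Homeomorph.subLeft x)⟩

theorem IsTest.gradient_comp_const_sub {ρ : R3 → ℝ} (h : IsTest ρ) (x t : R3) :
    ∇ (fun t => ρ (x - t)) t = -∇ ρ (x - t) := by
  have h1 : HasFDerivAt ρ (fderiv ℝ ρ (x - t)) (x - t) :=
    (h.1.differentiable (by simp)).differentiableAt.hasFDerivAt
  have h2 := h1.comp t ((hasFDerivAt_id t).const_sub x)
  have h3 : fderiv ℝ (fun t => ρ (x - t)) t = -fderiv ℝ ρ (x - t) := by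
    have : fderiv ℝ (fun t => ρ (x - t)) t = _ := h2.fderiv
    simpa using this
  simp [gradient, h3]

/-- Mollification commutes with the weak gradient: `∇(ρ ⋆ f) = ρ ⋆ G`. The weak gradient identity
is tested against `t ↦ ρ (x - t)`. -/
theorem HasWeakGradient.hasGradientAt_convolution {f : R3 → ℝ} {G : R3 → R3}
    (hf : LocallyIntegrable f) (hw : HasWeakGradient f G) {ρ : R3 → ℝ} (hρ : IsTest ρ) (x : R3) :
    HasGradientAt (ρ ⋆[ContinuousLinearMap.lsmul ℝ ℝ] f)
      ((ρ ⋆[ContinuousLinearMap.lsmul ℝ ℝ] G) x) x := by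
  rw [hasGradientAt_iff_hasFDerivAt]
  have h1 := hρ.2.hasFDerivAt_convolution_left (ContinuousLinearMap.lsmul ℝ ℝ)
    (hρ.1.of_le (by simp)) hf x
  refine h1.congr_fderiv ?_
  have h2 := hw _ (hρ.comp_const_sub x)
  simp only [hρ.gradient_comp_const_sub, smul_neg, integral_neg, neg_inj] at h2
  rw [convolution_eq_swap, convolution_eq_swap]
  simp only [ContinuousLinearMap.lsmul_apply]
  rw [← h2]
  have h3 := LinearIsometry.integral_comp_comm (𝕜 := ℝ) (μ := (volume : Measure R3))
    (InnerProductSpace.toDual ℝ R3).toLinearIsometry (fun t => f t • ∇ ρ (x - t))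
  refine Eq.trans ?_ h3
  refine integral_congr_ae (Eventually.of_forall fun t => ?_)
  ext v
  change _ = inner ℝ (f t • ∇ ρ (x - t)) v
  rw [real_inner_smul_left, inner_gradient]
  simp [mul_comm]

theorem lintegral_sq_le_of_prob {ν : Measure R3} [IsProbabilityMeasure ν] {h : R3 → ENNReal}
    (hh : AEMeasurable h ν) : (∫⁻ t, h t ∂ν) ^ 2 ≤ ∫⁻ t, h t ^ 2 ∂ν := by
  have := ENNReal.lintegral_mul_le_Lp_mul_Lq ν Real.HolderConjugate.two_two hh
    (aemeasurable_const (b := 1))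
  simp only [Pi.mul_apply, mul_one, ENNReal.one_rpow, lintegral_const, measure_univ] at this
  calc (∫⁻ t, h t ∂ν) ^ 2 ≤ ((∫⁻ t, h t ^ (2 : ℝ) ∂ν) ^ (1 / 2 : ℝ)) ^ 2 := by gcongr
    _ = ∫⁻ t, h t ^ 2 ∂ν := by
      rw [← ENNReal.rpow_natCast, ← ENNReal.rpow_mul]
      norm_num

/-- Young's inequality in `L²` for a probability density `ρ`, a consequence of Jensen's inequality
and Tonelli's theorem. -/
theorem eLpNorm_convolution_le {F : Type*} [NormedAddCommGroup F] [NormedSpace ℝ F]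
    {ρ : R3 → ℝ} (hc : Continuous ρ) (h0 : ∀ x, 0 ≤ ρ x) (hi : Integrable ρ) (h1 : ∫ x, ρ x = 1)
    {g : R3 → F} (hg : AEStronglyMeasurable g) :
    eLpNorm (ρ ⋆[ContinuousLinearMap.lsmul ℝ ℝ] g) 2 ≤ eLpNorm g 2 := by
  set ν : Measure R3 := volume.withDensity (fun t => ENNReal.ofReal (ρ t)) with hν
  have hm : Measurable fun t => ENNReal.ofReal (ρ t) := hc.measurable.ennreal_ofReal
  have : IsProbabilityMeasure ν := by
    constructor
    rw [hν, withDensity_apply _ MeasurableSet.univ, Measure.restrict_univ,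
      ← ofReal_integral_eq_lintegral_ofReal hi (Eventually.of_forall h0), h1, ENNReal.ofReal_one]
  have hac : ν ≪ volume := withDensity_absolutelyContinuous _ _
  have hgs : ∀ x, AEStronglyMeasurable (fun t => g (x - t)) := fun x =>
    hg.comp_measurePreserving (volume.measurePreserving_sub_left x)
  have hpt : ∀ x, ‖(ρ ⋆[ContinuousLinearMap.lsmul ℝ ℝ] g) x‖ₑ ^ 2
      ≤ ∫⁻ t, ENNReal.ofReal (ρ t) * ‖g (x - t)‖ₑ ^ 2 := by
    intro x
    calc ‖(ρ ⋆[ContinuousLinearMap.lsmul ℝ ℝ] g) x‖ₑ ^ 2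
        ≤ (∫⁻ t, ‖ρ t • g (x - t)‖ₑ) ^ 2 := by
          gcongr
          exact enorm_integral_le_lintegral_enorm _
      _ = (∫⁻ t, ‖g (x - t)‖ₑ ∂ν) ^ 2 := by
          rw [hν, lintegral_withDensity_eq_lintegral_mul₀ hm.aemeasurable (hgs x).enorm]
          congr 2
          funext t
          simp [enorm_smul, Real.enorm_of_nonneg (h0 t)]
      _ ≤ ∫⁻ t, ‖g (x - t)‖ₑ ^ 2 ∂ν :=
          lintegral_sq_le_of_prob ((hgs x).mono_ac hac).enorm
      _ = _ := by
          rw [hν, lintegral_withDensity_eq_lintegral_mul₀ hm.aemeasurable ((hgs x).enorm.pow_const 2)]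
          rfl
  have key : ∫⁻ x, ‖(ρ ⋆[ContinuousLinearMap.lsmul ℝ ℝ] g) x‖ₑ ^ 2 ≤ ∫⁻ x, ‖g x‖ₑ ^ 2 := by
    calc _ ≤ ∫⁻ x, ∫⁻ t, ENNReal.ofReal (ρ t) * ‖g (x - t)‖ₑ ^ 2 := lintegral_mono hpt
      _ = ∫⁻ t, ∫⁻ x, ENNReal.ofReal (ρ t) * ‖g (x - t)‖ₑ ^ 2 := by
          apply lintegral_lintegral_swap
          refine (hm.comp measurable_snd).aemeasurable.mul ?_
          exact (hg.comp_quasiMeasurePreserving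
            (quasiMeasurePreserving_sub_of_right_invariant volume volume)).enorm.pow_const 2
      _ = ∫⁻ t, ENNReal.ofReal (ρ t) * ∫⁻ x, ‖g x‖ₑ ^ 2 := by
          congr 1
          funext t
          rw [lintegral_const_mul' _ _ ENNReal.ofReal_ne_top,
            lintegral_sub_right_eq_self (fun x => ‖g x‖ₑ ^ 2) t]
      _ = (∫⁻ t, ENNReal.ofReal (ρ t)) * ∫⁻ x, ‖g x‖ₑ ^ 2 := lintegral_mul_const _ hm
      _ = _ := by
          rw [← ofReal_integral_eq_lintegral_ofReal hi (Eventually.of_forall h0), h1]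
          simp
  have e : ∀ w : R3 → F, eLpNorm w 2 = (∫⁻ x, ‖w x‖ₑ ^ 2) ^ (1 / 2 : ℝ) := by
    intro w
    rw [eLpNorm_eq_lintegral_rpow_enorm_toReal (by simp) (by simp)]
    simp
  rw [e, e]
  gcongr

/-- A sequence of bump functions at the origin, with supports shrinking to a point. -/
noncomputable def bump (n : ℕ) : ContDiffBump (0 : R3) where
  rIn := 1 / ((n : ℝ) + 1)
  rOut := 2 / ((n : ℝ) + 1)
  rIn_pos := by positivity
  rIn_lt_rOut := by gcongr; norm_num

/-- The standard mollifiers: smooth probability densities concentrating at the origin. -/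
noncomputable def mollifier (n : ℕ) : R3 → ℝ := (bump n).normed volume

theorem isTest_mollifier (n : ℕ) : IsTest (mollifier n) :=
  ⟨(bump n).contDiff_normed, (bump n).hasCompactSupport_normed⟩

theorem mollifier_nonneg (n : ℕ) (x : R3) : 0 ≤ mollifier n x := (bump n).nonneg_normed x

theorem integral_mollifier (n : ℕ) : ∫ x, mollifier n x = 1 := (bump n).integral_normed

theorem integrable_mollifier (n : ℕ) : Integrable (mollifier n) := (bump n).integrable_normed

theorem tendsto_bump_rOut : Tendsto (fun n => (bump n).rOut) atTop (𝓝 0) := by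
  have := (tendsto_one_div_add_atTop_nhds_zero_nat (𝕜 := ℝ)).const_mul 2
  simpa [bump, div_eq_mul_inv] using this

theorem ae_tendsto_mollifier {F : Type*} [NormedAddCommGroup F] [NormedSpace ℝ F] [CompleteSpace F]
    {g : R3 → F} (hg : LocallyIntegrable g) :
    ∀ᵐ x, Tendsto (fun n => (mollifier n ⋆[ContinuousLinearMap.lsmul ℝ ℝ] g) x) atTop (𝓝 (g x)) :=
  ContDiffBump.ae_convolution_tendsto_right_of_locallyIntegrable (K := 2) tendsto_bump_rOut
    (Eventually.of_forall fun n => by simp only [bump]; exact le_of_eq (by ring)) hg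

/-- A Lipschitz function has its classical gradient as weak gradient. -/
theorem hasWeakGradient_of_lipschitz {f : R3 → ℝ} {K : NNReal} (hf : LipschitzWith K f) :
    HasWeakGradient f (∇ f) := by
  intro ψ hψ
  obtain ⟨D, hD⟩ := (hψ.1.of_le (m := 1) (by simp)).lipschitzWith_of_hasCompactSupport hψ.2 (by simp)
  have hi1 : Integrable (fun x => f x • ∇ ψ x) :=
    (hf.continuous.smul hψ.continuous_gradient).integrable_of_hasCompactSupport
      (hψ.hasCompactSupport_gradient.smul_left)
  have hi2 : Integrable (fun x => ψ x • ∇ f x) := by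
    have h1 : Integrable ψ := hψ.1.continuous.integrable_of_hasCompactSupport hψ.2
    refine (h1.norm.mul_const (K : ℝ)).mono' ?_ (Eventually.of_forall fun x => ?_)
    · exact hψ.1.continuous.aestronglyMeasurable.smul (measurable_gradient f).aestronglyMeasurable
    · rw [norm_smul]
      gcongr
      rw [norm_gradient]
      exact norm_fderiv_le_of_lipschitz ℝ hf
  refine ext_inner_left ℝ fun v => ?_
  rw [inner_neg_right, ← integral_inner hi1, ← integral_inner hi2]
  have h := hf.integral_lineDeriv_mul_eq (μ := volume) hD hψ.2 v
  have e1 : ∫ x, lineDeriv ℝ f x v * ψ x = ∫ x, inner ℝ v (ψ x • ∇ f x) := by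
    refine integral_congr_ae ?_
    filter_upwards [hf.ae_differentiableAt (μ := volume)] with x hx
    rw [hx.lineDeriv_eq_fderiv, inner_smul_right, real_inner_comm, inner_gradient]
    simp [mul_comm]
  have e2 : ∫ x, lineDeriv ℝ ψ x (-v) * f x = -∫ x, inner ℝ v (f x • ∇ ψ x) := by
    rw [← integral_neg]
    refine integral_congr_ae (Eventually.of_forall fun x => ?_)
    have hx : DifferentiableAt ℝ ψ x := (hψ.1.differentiable (by simp)).differentiableAt
    change lineDeriv ℝ ψ x (-v) * f x = -inner ℝ v (f x • ∇ ψ x)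
    rw [hx.lineDeriv_eq_fderiv, inner_smul_right, real_inner_comm, inner_gradient]
    simp [mul_comm]
  linarith

/-- A Lipschitz function whose gradient is almost everywhere at most `1` is `1`-Lipschitz: its
mollifications are, because their gradients are averages of `∇ f`. -/
theorem lipschitzWith_one_of_gradient {f : R3 → ℝ} {K : NNReal} (hf : LipschitzWith K f)
    (h1 : ∀ᵐ x, ‖∇ f x‖ ≤ 1) : LipschitzWith 1 f := by
  have hg := fun n x => (hasWeakGradient_of_lipschitz hf).hasGradientAt_convolution
    hf.continuous.locallyIntegrable (isTest_mollifier n) x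
  have hL : ∀ n, LipschitzWith 1 (mollifier n ⋆[ContinuousLinearMap.lsmul ℝ ℝ] f) := by
    intro n
    refine lipschitzWith_of_nnnorm_fderiv_le (𝕜 := ℝ)
      (fun x => (hg n x).hasFDerivAt.differentiableAt) fun x => ?_
    rw [(hg n x).hasFDerivAt.fderiv, ← NNReal.coe_le_coe, coe_nnnorm, LinearIsometryEquiv.norm_map,
      NNReal.coe_one, ← integral_mollifier n]
    refine norm_integral_le_of_norm_le (integrable_mollifier n) ?_
    filter_upwards [(volume.measurePreserving_sub_left x).quasiMeasurePreserving.ae h1] with t ht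
    simp only [ContinuousLinearMap.lsmul_apply, norm_smul,
      Real.norm_of_nonneg (mollifier_nonneg n t)]
    exact mul_le_of_le_one_right (mollifier_nonneg n t) ht
  have ht : ∀ x, Tendsto (fun n => (mollifier n ⋆[ContinuousLinearMap.lsmul ℝ ℝ] f) x) atTop
      (𝓝 (f x)) := fun x =>
    ContDiffBump.convolution_tendsto_right_of_continuous tendsto_bump_rOut hf.continuous x
  refine LipschitzWith.of_dist_le_mul fun x y => ?_
  exact le_of_tendsto ((ht x).dist (ht y)) (Eventually.of_forall fun n => (hL n).dist_le_mul x y)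

/-! ### The Sobolev inequality -/

/-- The constant of the Sobolev inequality `‖f‖₆ ≤ S ‖∇f‖₂` in `ℝ³`. -/
noncomputable def sobolevConst : ℝ≥0 := SNormLESNormFDerivOfEqConst ℝ (volume : Measure R3) 2

theorem eLpNorm_gradient (f : R3 → ℝ) (q : ℝ≥0∞) :
    eLpNorm (∇ f) q = eLpNorm (fderiv ℝ f) q :=
  eLpNorm_congr_norm_ae (Eventually.of_forall fun x => norm_gradient f x)

theorem sobolev_of_hasCompactSupport {w : R3 → ℝ} (hw : ContDiff ℝ 1 w)
    (hc : HasCompactSupport w) : eLpNorm w 6 ≤ sobolevConst * eLpNorm (fderiv ℝ w) 2 := by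
  have h := eLpNorm_le_eLpNorm_fderiv_of_eq (volume : Measure R3) hw hc (p := 2) (p' := 6)
    (by norm_num) (by simp) (by simp; norm_num)
  exact_mod_cast h

/-- Fatou's lemma: bounds on `Lᵖ` norms pass to almost everywhere limits. -/
theorem eLpNorm_le_of_ae_tendsto {F : Type*} [NormedAddCommGroup F] {g : ℕ → R3 → F} {f : R3 → F}
    {q : ℝ≥0∞} (hm : ∀ n, AEStronglyMeasurable (g n))
    (ht : ∀ᵐ x, Tendsto (fun n => g n x) atTop (𝓝 (f x))) {b : ℕ → ℝ≥0∞} {B : ℝ≥0∞}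
    (hb : ∀ n, eLpNorm (g n) q ≤ b n) (hB : Tendsto b atTop (𝓝 B)) : eLpNorm f q ≤ B := by
  refine (Lp.eLpNorm_lim_le_liminf_eLpNorm hm f ht).trans ?_
  rw [← hB.liminf_eq]
  exact liminf_le_liminf (Eventually.of_forall hb)

/-- Cutoff functions at scale `n`, with gradients of size `O(1 / n)`. -/
theorem exists_cutoff : ∃ (χ : ℕ → R3 → ℝ) (D : ℝ≥0), (∀ n, ContDiff ℝ 1 (χ n)) ∧
    (∀ n, HasCompactSupport (χ n)) ∧ (∀ n x, ‖χ n x‖ ≤ 1) ∧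
    (∀ n x, ‖fderiv ℝ (χ n) x‖ ≤ D * (1 / ((n : ℝ) + 1))) ∧
    ∀ x, Tendsto (fun n => χ n x) atTop (𝓝 1) := by
  let b : ContDiffBump (0 : R3) := ⟨1, 2, one_pos, one_lt_two⟩
  have hr : ∀ n : ℕ, (0 : ℝ) < 1 / ((n : ℝ) + 1) := fun n => by positivity
  have hb1 : ContDiff ℝ 1 b := b.contDiff
  obtain ⟨D, hD⟩ := hb1.lipschitzWith_of_hasCompactSupport b.hasCompactSupport (by simp)
  refine ⟨fun n x => b ((1 / ((n : ℝ) + 1)) • x), D, fun n => hb1.comp (contDiff_const_smul _),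
    fun n => b.hasCompactSupport.comp_smul (hr n).ne', fun n x => ?_, fun n x => ?_, fun x => ?_⟩
  · rw [Real.norm_of_nonneg b.nonneg]
    exact b.le_one
  · have hL : LipschitzWith (D * ⟨1 / ((n : ℝ) + 1), (hr n).le⟩)
        (fun x : R3 => b ((1 / ((n : ℝ) + 1)) • x)) :=
      hD.comp (LipschitzWith.of_dist_le_mul fun y z => by
        rw [dist_smul₀, Real.norm_of_nonneg (hr n).le]; rfl)
    exact norm_fderiv_le_of_lipschitz ℝ hL
  · have h1 : Tendsto (fun n : ℕ => (1 / ((n : ℝ) + 1)) • x) atTop (𝓝 0) := by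
      simpa using (tendsto_one_div_add_atTop_nhds_zero_nat (𝕜 := ℝ)).smul_const x
    have h2 := (hb1.continuous.tendsto 0).comp h1
    have h3 : b 0 = 1 := b.one_of_mem_closedBall (by simp [b])
    rw [h3] at h2
    exact h2

theorem eLpNorm_fderiv_mul_le {χ w : R3 → ℝ} (hχ : ContDiff ℝ 1 χ) (hw : ContDiff ℝ 1 w) {c : ℝ}
    (h1 : ∀ x, ‖χ x‖ ≤ 1) (hc : ∀ x, ‖fderiv ℝ χ x‖ ≤ c) :
    eLpNorm (fderiv ℝ fun x => χ x * w x) 2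
      ≤ eLpNorm (fderiv ℝ w) 2 + ENNReal.ofReal c * eLpNorm w 2 := by
  have hd : (fderiv ℝ fun x => χ x * w x)
      = (fun x => χ x • fderiv ℝ w x) + fun x => w x • fderiv ℝ χ x := funext fun x =>
    fderiv_fun_mul (hχ.differentiable (by simp)).differentiableAt
      (hw.differentiable (by simp)).differentiableAt
  have m1 : AEStronglyMeasurable (fun x => χ x • fderiv ℝ w x) volume :=
    (hχ.continuous.smul (hw.continuous_fderiv (by simp))).aestronglyMeasurable
  have m2 : AEStronglyMeasurable (fun x => w x • fderiv ℝ χ x) volume :=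
    (hw.continuous.smul (hχ.continuous_fderiv (by simp))).aestronglyMeasurable
  rw [hd]
  refine (eLpNorm_add_le m1 m2 one_le_two).trans (add_le_add ?_ ?_)
  · refine eLpNorm_mono fun x => ?_
    rw [norm_smul]
    exact mul_le_of_le_one_left (norm_nonneg _) (h1 x)
  · refine eLpNorm_le_mul_eLpNorm_of_ae_le_mul (Eventually.of_forall fun x => ?_) 2
    rw [norm_smul, mul_comm]
    exact mul_le_mul_of_nonneg_right (hc x) (norm_nonneg _)

/-- The Sobolev inequality for a `C¹` function in `L²`, without compact support, by means of
cutoffs. -/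
theorem sobolev_of_memLp {w : R3 → ℝ} (hw : ContDiff ℝ 1 w) (h2 : MemLp w 2) :
    eLpNorm w 6 ≤ sobolevConst * eLpNorm (fderiv ℝ w) 2 := by
  obtain ⟨χ, D, hχ1, hχc, hχ_le, hχd, hχ⟩ := exists_cutoff
  have hχt : ∀ x, Tendsto (fun n => χ n x * w x) atTop (𝓝 (w x)) := fun x => by
    simpa using (hχ x).mul_const (w x)
  have hbound : ∀ n, eLpNorm (fun x => χ n x * w x) 6
      ≤ sobolevConst * (eLpNorm (fderiv ℝ w) 2
        + ENNReal.ofReal (D * (1 / ((n : ℝ) + 1))) * eLpNorm w 2) := by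
    intro n
    refine (sobolev_of_hasCompactSupport ((hχ1 n).mul hw) ((hχc n).mul_right)).trans ?_
    exact mul_le_mul' le_rfl (eLpNorm_fderiv_mul_le (hχ1 n) hw (hχ_le n) (hχd n))
  have hlim : Tendsto (fun n : ℕ => (sobolevConst : ℝ≥0∞) * (eLpNorm (fderiv ℝ w) 2
        + ENNReal.ofReal (D * (1 / ((n : ℝ) + 1))) * eLpNorm w 2)) atTop
      (𝓝 (sobolevConst * eLpNorm (fderiv ℝ w) 2)) := by
    have h1 : Tendsto (fun n : ℕ => ENNReal.ofReal (D * (1 / ((n : ℝ) + 1)))) atTop (𝓝 0) := by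
      rw [← ENNReal.ofReal_zero]
      refine ENNReal.tendsto_ofReal ?_
      simpa using (tendsto_one_div_add_atTop_nhds_zero_nat (𝕜 := ℝ)).const_mul (D : ℝ)
    have h3 := (ENNReal.Tendsto.mul_const h1 (Or.inr h2.2.ne)).const_add (eLpNorm (fderiv ℝ w) 2)
    rw [zero_mul, add_zero] at h3
    exact ENNReal.Tendsto.const_mul h3 (Or.inr ENNReal.coe_ne_top)
  exact eLpNorm_le_of_ae_tendsto
    (fun n => ((hχ1 n).continuous.mul hw.continuous).aestronglyMeasurable)
    (Eventually.of_forall hχt) hbound hlim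

/-- The Sobolev inequality for an `L²` function with weak gradient in `L²`: mollify, apply the
inequality for smooth functions together with Young's inequality, and pass to the limit by Fatou's
lemma. -/
theorem HasWeakGradient.eLpNorm_six_le {f : R3 → ℝ} {G : R3 → R3} (hw : HasWeakGradient f G)
    (hf : MemLp f 2) (hG : MemLp G 2) : eLpNorm f 6 ≤ sobolevConst * eLpNorm G 2 := by
  have hloc : LocallyIntegrable f := hf.locallyIntegrable (by norm_num)
  have hcd : ∀ n, ContDiff ℝ 1 (mollifier n ⋆[ContinuousLinearMap.lsmul ℝ ℝ] f) := fun n =>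
    (isTest_mollifier n).2.contDiff_convolution_left _ ((isTest_mollifier n).1.of_le (by simp)) hloc
  have hYf : ∀ n,
      eLpNorm (mollifier n ⋆[ContinuousLinearMap.lsmul ℝ ℝ] f) 2 ≤ eLpNorm f 2 := fun n =>
    eLpNorm_convolution_le (isTest_mollifier n).1.continuous (mollifier_nonneg n)
      (integrable_mollifier n) (integral_mollifier n) hf.1
  have hYG : ∀ n,
      eLpNorm (mollifier n ⋆[ContinuousLinearMap.lsmul ℝ ℝ] G) 2 ≤ eLpNorm G 2 := fun n =>
    eLpNorm_convolution_le (isTest_mollifier n).1.continuous (mollifier_nonneg n)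
      (integrable_mollifier n) (integral_mollifier n) hG.1
  have hb : ∀ n, eLpNorm (mollifier n ⋆[ContinuousLinearMap.lsmul ℝ ℝ] f) 6
      ≤ sobolevConst * eLpNorm G 2 := by
    intro n
    refine (sobolev_of_memLp (hcd n) ⟨(hcd n).continuous.aestronglyMeasurable,
      (hYf n).trans_lt hf.2⟩).trans ?_
    refine mul_le_mul' le_rfl ?_
    refine le_trans (le_of_eq ?_) (hYG n)
    refine eLpNorm_congr_norm_ae (Eventually.of_forall fun x => ?_)
    rw [(hw.hasGradientAt_convolution hloc (isTest_mollifier n) x).hasFDerivAt.fderiv,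
      LinearIsometryEquiv.norm_map]
  exact eLpNorm_le_of_ae_tendsto (fun n => (hcd n).continuous.aestronglyMeasurable)
    (ae_tendsto_mollifier hloc) hb tendsto_const_nhds

/-- Interpolation between `L²` and `L⁶`. -/
theorem eLpNorm_le_max {f : R3 → ℝ} (hf : AEStronglyMeasurable f) {q : ℝ} (h2 : 2 ≤ q)
    (h6 : q ≤ 6) :
    eLpNorm f (ENNReal.ofReal q) ≤ max (eLpNorm f 2) (eLpNorm f 6) := by
  set M := max (eLpNorm f 2) (eLpNorm f 6) with hM
  have hq : 0 < q := by linarith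
  have e2 : ∫⁻ x, ‖f x‖ₑ ^ (2 : ℝ) ≤ M ^ (2 : ℝ) := by
    have := eLpNorm_nnreal_pow_eq_lintegral (μ := volume) (f := f) (p := 2) (by norm_num)
    refine (Eq.symm this).trans_le ?_
    rw [NNReal.coe_ofNat, ENNReal.coe_ofNat]
    gcongr
    exact le_max_left _ _
  have e6 : ∫⁻ x, ‖f x‖ₑ ^ (6 : ℝ) ≤ M ^ (6 : ℝ) := by
    have := eLpNorm_nnreal_pow_eq_lintegral (μ := volume) (f := f) (p := 6) (by norm_num)
    refine (Eq.symm this).trans_le ?_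
    rw [NNReal.coe_ofNat, ENNReal.coe_ofNat]
    gcongr
    exact le_max_right _ _
  -- the weights with `a + b = 1` and `2 a + 6 b = q`
  set a : ℝ := (6 - q) / 4
  set b : ℝ := (q - 2) / 4
  have ha : 0 ≤ a := by simp only [a]; linarith
  have hb : 0 ≤ b := by simp only [b]; linarith
  have hab : a + b = 1 := by simp only [a, b]; ring
  have hq' : 2 * a + 6 * b = q := by simp only [a, b]; ring
  have key : ∫⁻ x, ‖f x‖ₑ ^ q ≤ M ^ q := by
    calc ∫⁻ x, ‖f x‖ₑ ^ q = ∫⁻ x, (‖f x‖ₑ ^ (2 : ℝ)) ^ a * (‖f x‖ₑ ^ (6 : ℝ)) ^ b := by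
          congr 1
          funext x
          rw [← ENNReal.rpow_mul, ← ENNReal.rpow_mul,
            ← ENNReal.rpow_add_of_nonneg _ _ (by positivity) (by positivity), hq']
      _ ≤ (∫⁻ x, ‖f x‖ₑ ^ (2 : ℝ)) ^ a * (∫⁻ x, ‖f x‖ₑ ^ (6 : ℝ)) ^ b :=
          ENNReal.lintegral_mul_norm_pow_le (hf.enorm.pow_const _) (hf.enorm.pow_const _) ha hb hab
      _ ≤ (M ^ (2 : ℝ)) ^ a * (M ^ (6 : ℝ)) ^ b := by gcongr
      _ = M ^ q := by
          rw [← ENNReal.rpow_mul, ← ENNReal.rpow_mul,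
            ← ENNReal.rpow_add_of_nonneg _ _ (by positivity) (by positivity), hq']
  rw [eLpNorm_eq_lintegral_rpow_enorm_toReal (by simpa using hq) ENNReal.ofReal_ne_top,
    ENNReal.toReal_ofReal hq.le]
  calc (∫⁻ x, ‖f x‖ₑ ^ q) ^ (1 / q) ≤ (M ^ q) ^ (1 / q) := by gcongr
    _ = M := by rw [← ENNReal.rpow_mul, mul_one_div_cancel hq.ne', ENNReal.rpow_one]

theorem H1.hasWeakGradient (u : H1) : HasWeakGradient (H1.fn u) (H1.grad u) := u.2

theorem H1.memLp_fn (u : H1) : MemLp (H1.fn u) 2 := Lp.memLp _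

theorem H1.memLp_grad (u : H1) : MemLp (H1.grad u) 2 := Lp.memLp _

theorem H1.eLpNorm_fn_le (u : H1) : eLpNorm (H1.fn u) 2 ≤ ENNReal.ofReal ‖u‖ := by
  have h : ‖u.1.fst‖ ≤ ‖u‖ := WithLp.norm_fst_le _ u.1
  rw [Lp.norm_def] at h
  exact (ENNReal.le_ofReal_iff_toReal_le (H1.memLp_fn u).2.ne (norm_nonneg _)).2 h

theorem H1.eLpNorm_grad_le (u : H1) : eLpNorm (H1.grad u) 2 ≤ ENNReal.ofReal ‖u‖ := by
  have h : ‖u.1.snd‖ ≤ ‖u‖ := WithLp.norm_snd_le _ u.1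
  rw [Lp.norm_def] at h
  exact (ENNReal.le_ofReal_iff_toReal_le (H1.memLp_grad u).2.ne (norm_nonneg _)).2 h

theorem H1.eLpNorm_le {q : ℝ} (h2 : 2 ≤ q) (h6 : q ≤ 6) (u : H1) :
    eLpNorm (H1.fn u) (ENNReal.ofReal q) ≤ ENNReal.ofReal ((1 + sobolevConst) * ‖u‖) := by
  have hS : (0 : ℝ) ≤ sobolevConst := sobolevConst.2
  have ha := H1.eLpNorm_fn_le u
  have hb := (H1.hasWeakGradient u).eLpNorm_six_le (H1.memLp_fn u) (H1.memLp_grad u)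
  have hc := hb.trans (mul_le_mul' le_rfl (H1.eLpNorm_grad_le u))
  have hu : 0 ≤ ‖u‖ := norm_nonneg u
  refine (eLpNorm_le_max (H1.memLp_fn u).1 h2 h6).trans ?_
  generalize ‖u‖ = r at *
  rw [← ENNReal.ofReal_coe_nnreal, ← ENNReal.ofReal_mul hS] at hc
  refine max_le (ha.trans (ENNReal.ofReal_le_ofReal ?_)) (hc.trans (ENNReal.ofReal_le_ofReal ?_))
  · nlinarith
  · nlinarith

theorem H1.memLp {q : ℝ} (h2 : 2 ≤ q) (h6 : q ≤ 6) (u : H1) : MemLp (H1.fn u) (ENNReal.ofReal q) :=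
  ⟨(H1.memLp_fn u).1, (H1.eLpNorm_le h2 h6 u).trans_lt ENNReal.ofReal_lt_top⟩

theorem H1.fn_add (u v : H1) : H1.fn (u + v) =ᵐ[volume] H1.fn u + H1.fn v := Lp.coeFn_add _ _

theorem H1.fn_smul (c : ℝ) (u : H1) : H1.fn (c • u) =ᵐ[volume] c • H1.fn u := Lp.coeFn_smul _ _

/-- The Sobolev embedding `H¹ → L^q`, for `2 ≤ q ≤ 6`. -/
noncomputable def H1.toLq (q : ℝ) (h2 : 2 ≤ q) (h6 : q ≤ 6) [Fact (1 ≤ ENNReal.ofReal q)] :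
    H1 →L[ℝ] Lp ℝ (ENNReal.ofReal q) (volume : Measure R3) :=
  LinearMap.mkContinuous
    { toFun := fun u => (H1.memLp h2 h6 u).toLp _
      map_add' := fun u v => by
        exact (MemLp.toLp_congr _ ((H1.memLp h2 h6 u).add (H1.memLp h2 h6 v))
          (H1.fn_add u v)).trans (MemLp.toLp_add _ _)
      map_smul' := fun c u => by
        exact (MemLp.toLp_congr _ ((H1.memLp h2 h6 u).const_smul c)
          (H1.fn_smul c u)).trans (MemLp.toLp_const_smul _ _) }
    (1 + sobolevConst) fun u => by
      change ‖(H1.memLp h2 h6 u).toLp _‖ ≤ _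
      refine (Lp.norm_toLp _ _).trans_le ?_
      exact ENNReal.toReal_le_of_le_ofReal (by positivity) (H1.eLpNorm_le h2 h6 u)

theorem H1.coeFn_toLq (q : ℝ) (h2 : 2 ≤ q) (h6 : q ≤ 6) [Fact (1 ≤ ENNReal.ofReal q)] (u : H1) :
    H1.toLq q h2 h6 u =ᵐ[volume] H1.fn u :=
  (H1.memLp h2 h6 u).coeFn_toLp

/-! ### The space `D^{1,2}` -/

/-- `φ` is an element of `D^{1,2}(ℝ³)` with gradient `G`: some sequence of test functions converges
to `φ` in `L⁶`, while the gradients converge to `G` in `L²`. -/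
def HasD12Gradient (φ : R3 → ℝ) (G : R3 → R3) : Prop :=
  ∃ ψ : ℕ → R3 → ℝ, (∀ n, IsTest (ψ n)) ∧ MemLp G 2 ∧
    Tendsto (fun n => eLpNorm (fun x => ∇ (ψ n) x - G x) 2) atTop (𝓝 0) ∧
    Tendsto (fun n => eLpNorm (fun x => ψ n x - φ x) 6) atTop (𝓝 0)

theorem memD12_iff {φ : R3 → ℝ} : MemD12 φ ↔ ∃ G, HasD12Gradient φ G := by
  constructor
  · rintro ⟨ψ, G, h⟩
    exact ⟨G, ψ, h⟩
  · rintro ⟨G, ψ, h⟩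
    exact ⟨ψ, G, h⟩

theorem IsTest.differentiable {ψ : R3 → ℝ} (h : IsTest ψ) : Differentiable ℝ ψ :=
  h.1.differentiable (by simp)

theorem IsTest.memLp {ψ : R3 → ℝ} (h : IsTest ψ) (q : ℝ≥0∞) : MemLp ψ q :=
  h.1.continuous.memLp_of_hasCompactSupport h.2

theorem IsTest.memLp_gradient {ψ : R3 → ℝ} (h : IsTest ψ) (q : ℝ≥0∞) : MemLp (∇ ψ) q :=
  h.continuous_gradient.memLp_of_hasCompactSupport h.hasCompactSupport_gradient

theorem IsTest.sobolev {ψ : R3 → ℝ} (h : IsTest ψ) :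
    eLpNorm ψ 6 ≤ sobolevConst * eLpNorm (∇ ψ) 2 := by
  rw [eLpNorm_gradient]
  exact sobolev_of_hasCompactSupport (h.1.of_le (by simp)) h.2

theorem gradient_combo {f g : R3 → ℝ} {x : R3} (hf : DifferentiableAt ℝ f x)
    (hg : DifferentiableAt ℝ g x) (a b : ℝ) :
    ∇ (fun x => a * f x + b * g x) x = a • ∇ f x + b • ∇ g x := by
  have h := ((hf.hasFDerivAt.const_mul a).add (hg.hasFDerivAt.const_mul b)).fderiv
  have h' : fderiv ℝ (fun x => a * f x + b * g x) x = a • fderiv ℝ f x + b • fderiv ℝ g x := h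
  simp [gradient, h']

theorem eLpNorm_combo_le {F : Type*} [NormedAddCommGroup F] [NormedSpace ℝ F] {f g : R3 → F}
    (hf : AEStronglyMeasurable f) (hg : AEStronglyMeasurable g) (a b : ℝ) {q : ℝ≥0∞} (hq : 1 ≤ q) :
    eLpNorm (fun x => a • f x + b • g x) q ≤ ‖a‖ₑ * eLpNorm f q + ‖b‖ₑ * eLpNorm g q := by
  refine (eLpNorm_add_le (hf.const_smul a) (hg.const_smul b) hq).trans (le_of_eq ?_)
  rw [eLpNorm_const_smul, eLpNorm_const_smul]

theorem HasD12Gradient.memLp_gradient {φ : R3 → ℝ} {G : R3 → R3} (h : HasD12Gradient φ G) :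
    MemLp G 2 := by
  obtain ⟨-, -, hG, -⟩ := h
  exact hG

theorem HasD12Gradient.memLp {φ : R3 → ℝ} {G : R3 → R3} (h : HasD12Gradient φ G)
    (hφ : AEStronglyMeasurable φ) : MemLp φ 6 := by
  obtain ⟨ψ, hψ, -, -, h6⟩ := h
  obtain ⟨n, hn⟩ := (h6.eventually (gt_mem_nhds ENNReal.zero_lt_top)).exists
  have h1 : MemLp (fun x => ψ n x - φ x) 6 :=
    ⟨((hψ n).memLp 6).1.sub hφ, hn⟩
  have h2 := ((hψ n).memLp 6).sub h1
  convert h2 using 1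
  ext x
  simp

theorem HasD12Gradient.combo {φ χ : R3 → ℝ} {G H : R3 → R3} (h : HasD12Gradient φ G)
    (k : HasD12Gradient χ H) (hφ : AEStronglyMeasurable φ) (hχ : AEStronglyMeasurable χ)
    (a b : ℝ) :
    HasD12Gradient (fun x => a * φ x + b * χ x) (fun x => a • G x + b • H x) := by
  obtain ⟨ψ, hψ, hG, hψG, hψφ⟩ := h
  obtain ⟨η, hη, hH, hηH, hηχ⟩ := k
  have hlim : ∀ {s t : ℕ → ℝ≥0∞}, Tendsto s atTop (𝓝 0) → Tendsto t atTop (𝓝 0) →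
      Tendsto (fun n => ‖a‖ₑ * s n + ‖b‖ₑ * t n) atTop (𝓝 0) := by
    intro s t hs ht
    simpa using (ENNReal.Tendsto.const_mul hs (Or.inr enorm_ne_top)).add
      (ENNReal.Tendsto.const_mul ht (Or.inr enorm_ne_top))
  refine ⟨fun n x => a * ψ n x + b * η n x, fun n => ⟨?_, ?_⟩,
    (hG.const_smul a).add (hH.const_smul b), ?_, ?_⟩
  · exact (contDiff_const.mul (hψ n).1).add (contDiff_const.mul (hη n).1)
  · exact ((hψ n).2.mul_left).add ((hη n).2.mul_left)
  · refine tendsto_of_tendsto_of_tendsto_of_le_of_le tendsto_const_nhds (hlim hψG hηH)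
      (fun _ => zero_le) fun n => ?_
    refine le_trans (le_of_eq ?_) (eLpNorm_combo_le (((hψ n).memLp_gradient 2).1.sub hG.1)
      (((hη n).memLp_gradient 2).1.sub hH.1) a b one_le_two)
    congr 1
    ext1 x
    rw [gradient_combo (hψ n).differentiable.differentiableAt (hη n).differentiable.differentiableAt]
    simp only [Pi.sub_apply, smul_sub]
    abel
  · refine tendsto_of_tendsto_of_tendsto_of_le_of_le tendsto_const_nhds (hlim hψφ hηχ)
      (fun _ => zero_le) fun n => ?_
    refine le_trans (le_of_eq ?_) (eLpNorm_combo_le (((hψ n).memLp 6).1.sub hφ)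
      (((hη n).memLp 6).1.sub hχ) a b (by norm_num))
    congr 1
    ext1 x
    simp only [Pi.sub_apply, smul_eq_mul]
    ring

/-- The Sobolev inequality in `D^{1,2}`. -/
theorem HasD12Gradient.sobolev {φ : R3 → ℝ} {G : R3 → R3} (h : HasD12Gradient φ G)
    (hφ : AEStronglyMeasurable φ) : eLpNorm φ 6 ≤ sobolevConst * eLpNorm G 2 := by
  obtain ⟨ψ, hψ, hG, h2, h6⟩ := h
  have hb : ∀ n, eLpNorm φ 6 ≤ sobolevConst *
      (eLpNorm G 2 + eLpNorm (fun x => ∇ (ψ n) x - G x) 2)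
        + eLpNorm (fun x => ψ n x - φ x) 6 := by
    intro n
    have e1 : φ = ψ n - fun x => ψ n x - φ x := by ext x; simp
    have e2 : ∇ (ψ n) = G + fun x => ∇ (ψ n) x - G x := by ext1 x; simp
    have i1 : eLpNorm φ 6 ≤ eLpNorm (ψ n) 6 + eLpNorm (fun x => ψ n x - φ x) 6 := by
      conv_lhs => rw [e1]
      exact eLpNorm_sub_le ((hψ n).memLp 6).1 (((hψ n).memLp 6).1.sub hφ) (by norm_num)
    have i2 : eLpNorm (∇ (ψ n)) 2 ≤ eLpNorm G 2 + eLpNorm (fun x => ∇ (ψ n) x - G x) 2 := by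
      conv_lhs => rw [e2]
      exact eLpNorm_add_le hG.1 (((hψ n).memLp_gradient 2).1.sub hG.1) one_le_two
    exact i1.trans (add_le_add ((hψ n).sobolev.trans (mul_le_mul' le_rfl i2)) le_rfl)
  have hl := (ENNReal.Tendsto.const_mul (h2.const_add (eLpNorm G 2))
    (Or.inr (ENNReal.coe_ne_top (r := sobolevConst)))).add h6
  simp only [add_zero] at hl
  exact ge_of_tendsto hl (Eventually.of_forall hb)

theorem tendsto_integral_smul_left {F : Type*} [NormedAddCommGroup F] [NormedSpace ℝ F]
    (p q : ℝ≥0∞) [ENNReal.HolderTriple p q 1] {s : ℕ → R3 → ℝ} {s' : R3 → ℝ} {t : R3 → F}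
    (hs : ∀ n, MemLp (s n) p) (hs' : MemLp s' p) (ht : MemLp t q)
    (hl : Tendsto (fun n => eLpNorm (fun x => s n x - s' x) p) atTop (𝓝 0)) :
    Tendsto (fun n => ∫ x, s n x • t x) atTop (𝓝 (∫ x, s' x • t x)) := by
  have hi : ∀ n, Integrable (fun x => s n x • t x) := fun n =>
    memLp_one_iff_integrable.1 (ht.smul (hs n))
  have hi' : Integrable (fun x => s' x • t x) := memLp_one_iff_integrable.1 (ht.smul hs')
  refine tendsto_integral_of_L1' _ hi'.1 (Eventually.of_forall hi) ?_
  have hl' := ENNReal.Tendsto.mul_const hl (Or.inr ht.2.ne)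
  rw [zero_mul] at hl'
  refine tendsto_of_tendsto_of_tendsto_of_le_of_le tendsto_const_nhds hl'
    (fun _ => zero_le) fun n => ?_
  have : ((fun x => s n x • t x) - fun x => s' x • t x) = (s n - s') • t := by
    ext1 x
    simp [sub_smul]
  rw [this]
  exact eLpNorm_smul_le_mul_eLpNorm ht.1 ((hs n).1.sub hs'.1)

theorem tendsto_integral_smul_right {F : Type*} [NormedAddCommGroup F] [NormedSpace ℝ F]
    (p q : ℝ≥0∞) [ENNReal.HolderTriple p q 1] {s : R3 → ℝ} {t : ℕ → R3 → F} {t' : R3 → F}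
    (hs : MemLp s p) (ht : ∀ n, MemLp (t n) q) (ht' : MemLp t' q)
    (hl : Tendsto (fun n => eLpNorm (fun x => t n x - t' x) q) atTop (𝓝 0)) :
    Tendsto (fun n => ∫ x, s x • t n x) atTop (𝓝 (∫ x, s x • t' x)) := by
  have hi : ∀ n, Integrable (fun x => s x • t n x) := fun n =>
    memLp_one_iff_integrable.1 ((ht n).smul hs)
  have hi' : Integrable (fun x => s x • t' x) := memLp_one_iff_integrable.1 (ht'.smul hs)
  refine tendsto_integral_of_L1' _ hi'.1 (Eventually.of_forall hi) ?_
  have hl' := ENNReal.Tendsto.const_mul hl (Or.inr hs.2.ne)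
  rw [mul_zero] at hl'
  refine tendsto_of_tendsto_of_tendsto_of_le_of_le tendsto_const_nhds hl'
    (fun _ => zero_le) fun n => ?_
  have : ((fun x => s x • t n x) - fun x => s x • t' x) = s • (t n - t') := by
    ext1 x
    simp [smul_sub]
  rw [this]
  exact eLpNorm_smul_le_mul_eLpNorm ((ht n).1.sub ht'.1) hs.1

theorem IsTest.lipschitz {ψ : R3 → ℝ} (h : IsTest ψ) : ∃ D, LipschitzWith D ψ :=
  (h.1.of_le (m := 1) (by simp)).lipschitzWith_of_hasCompactSupport h.2 (by simp)

theorem HasD12Gradient.hasWeakGradient {φ : R3 → ℝ} {G : R3 → R3} (h : HasD12Gradient φ G)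
    (hφ : AEStronglyMeasurable φ) : HasWeakGradient φ G := by
  have hφ6 := h.memLp hφ
  obtain ⟨ψ, hψ, hG, h2, h6⟩ := h
  intro η hη
  have : ENNReal.HolderConjugate 6 (ENNReal.conjExponent 6) :=
    ENNReal.HolderConjugate.conjExponent (by norm_num)
  have t1 := tendsto_integral_smul_left 6 (ENNReal.conjExponent 6) (fun n => (hψ n).memLp 6) hφ6
    (hη.memLp_gradient _) h6
  have t2 := tendsto_integral_smul_right 2 2 (hη.memLp 2) (fun n => (hψ n).memLp_gradient 2) hG h2
  have he : ∀ n, ∫ x, ψ n x • ∇ η x = -∫ x, η x • ∇ (ψ n) x := fun n => by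
    obtain ⟨D, hD⟩ := (hψ n).lipschitz
    exact hasWeakGradient_of_lipschitz hD η hη
  simp only [he] at t1
  exact tendsto_nhds_unique t1 t2.neg

/-- `D^{1,2}` is closed: limits in `L⁶` with gradients converging in `L²` stay in the space. -/
theorem HasD12Gradient.of_tendsto {φ : ℕ → R3 → ℝ} {G : ℕ → R3 → R3} {φ' : R3 → ℝ} {G' : R3 → R3}
    (h : ∀ n, HasD12Gradient (φ n) (G n)) (hφ : ∀ n, AEStronglyMeasurable (φ n))
    (hφ' : AEStronglyMeasurable φ') (hG' : MemLp G' 2)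
    (h2 : Tendsto (fun n => eLpNorm (fun x => G n x - G' x) 2) atTop (𝓝 0))
    (h6 : Tendsto (fun n => eLpNorm (fun x => φ n x - φ' x) 6) atTop (𝓝 0)) :
    HasD12Gradient φ' G' := by
  have hlim : Tendsto (fun n : ℕ => ((n : ℝ≥0∞) + 1)⁻¹) atTop (𝓝 0) := by
    have := ENNReal.tendsto_inv_nat_nhds_zero.comp (tendsto_add_atTop_nat 1)
    refine this.congr fun n => ?_
    simp
  have hch : ∀ n, ∃ ψ, IsTest ψ ∧ eLpNorm (fun x => ∇ ψ x - G n x) 2 < ((n : ℝ≥0∞) + 1)⁻¹ ∧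
      eLpNorm (fun x => ψ x - φ n x) 6 < ((n : ℝ≥0∞) + 1)⁻¹ := by
    intro n
    obtain ⟨ψ, hψ, -, a2, a6⟩ := h n
    have hpos : (0 : ℝ≥0∞) < ((n : ℝ≥0∞) + 1)⁻¹ := by
      rw [ENNReal.inv_pos]
      finiteness
    obtain ⟨m, hm⟩ := ((a2.eventually (gt_mem_nhds hpos)).and
      (a6.eventually (gt_mem_nhds hpos))).exists
    exact ⟨ψ m, hψ m, hm⟩
  choose ψ hψ b2 b6 using hch
  refine ⟨ψ, hψ, hG', ?_, ?_⟩
  · have hl := hlim.add h2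
    rw [add_zero] at hl
    refine tendsto_of_tendsto_of_tendsto_of_le_of_le tendsto_const_nhds hl
      (fun _ => zero_le) fun n => ?_
    have e : (fun x => ∇ (ψ n) x - G' x)
        = (fun x => ∇ (ψ n) x - G n x) + fun x => G n x - G' x := by
      ext1 x
      simp
    rw [e]
    have hGn := (h n).memLp_gradient
    exact (eLpNorm_add_le (((hψ n).memLp_gradient 2).1.sub hGn.1) (hGn.1.sub hG'.1)
      one_le_two).trans (add_le_add (b2 n).le le_rfl)
  · have hl := hlim.add h6
    rw [add_zero] at hl
    refine tendsto_of_tendsto_of_tendsto_of_le_of_le tendsto_const_nhds hl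
      (fun _ => zero_le) fun n => ?_
    have e : (fun x => ψ n x - φ' x) = (fun x => ψ n x - φ n x) + fun x => φ n x - φ' x := by
      ext1 x
      simp
    rw [e]
    exact (eLpNorm_add_le (((hψ n).memLp 6).1.sub (hφ n)) ((hφ n).sub hφ')
      (by norm_num)).trans (add_le_add (b6 n).le le_rfl)

theorem HasD12Gradient.congr {φ : R3 → ℝ} {G H : R3 → R3} (h : HasD12Gradient φ G)
    (hGH : G =ᵐ[volume] H) : HasD12Gradient φ H := by
  obtain ⟨ψ, hψ, hG, h2, h6⟩ := h
  refine ⟨ψ, hψ, (memLp_congr_ae hGH).1 hG, h2.congr fun n => eLpNorm_congr_ae ?_, h6⟩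
  filter_upwards [hGH] with x hx
  rw [hx]

/-- The `D^{1,2}` gradient of a Lipschitz function is its classical gradient. -/
theorem HasD12Gradient.ae_eq_gradient {φ : R3 → ℝ} {G : R3 → R3} (h : HasD12Gradient φ G)
    {K : ℝ≥0} (hK : LipschitzWith K φ) : G =ᵐ[volume] ∇ φ := by
  have hw := h.hasWeakGradient hK.continuous.aestronglyMeasurable
  refine ae_eq_of_integral_contDiff_smul_eq (h.memLp_gradient.locallyIntegrable one_le_two) ?_
    fun g hg hc => ?_
  · refine (memLp_top_of_bound (measurable_gradient φ).aestronglyMeasurable (K : ℝ)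
      (Eventually.of_forall fun x => ?_)).locallyIntegrable le_top
    rw [norm_gradient]
    exact norm_fderiv_le_of_lipschitz ℝ hK
  · have h1 := hw g ⟨hg, hc⟩
    rw [hasWeakGradient_of_lipschitz hK g ⟨hg, hc⟩] at h1
    exact (neg_injective h1).symm

/-! ### The constraint set `𝒳` and the Born–Infeld energy -/

instance : Fact ((1 : ℝ≥0∞) ≤ 6) := ⟨by norm_num⟩

/-- The Born–Infeld energy density `1 - √(1 - |z|²)`. -/
noncomputable def density (z : R3) : ℝ := 1 - √(1 - ‖z‖ ^ 2)

theorem continuous_density : Continuous density := by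
  unfold density
  fun_prop

theorem density_nonneg (z : R3) : 0 ≤ density z := by
  have : √(1 - ‖z‖ ^ 2) ≤ 1 := Real.sqrt_le_one.2 (by nlinarith [norm_nonneg z])
  unfold density
  linarith

theorem density_le (z : R3) (hz : ‖z‖ ≤ 1) : density z ≤ ‖z‖ ^ 2 := by
  have h0 : 0 ≤ 1 - ‖z‖ ^ 2 := by nlinarith [norm_nonneg z]
  have : 1 - ‖z‖ ^ 2 ≤ √(1 - ‖z‖ ^ 2) := Real.le_sqrt_of_sq_le (by nlinarith [sq_nonneg ‖z‖])
  unfold density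
  linarith

theorem half_sq_le_density (z : R3) (hz : ‖z‖ ≤ 1) : 1 / 2 * ‖z‖ ^ 2 ≤ density z := by
  have h0 : 0 ≤ 1 - ‖z‖ ^ 2 := by nlinarith [norm_nonneg z]
  have h1 := Real.sq_sqrt h0
  unfold density
  nlinarith [sq_nonneg (√(1 - ‖z‖ ^ 2) - 1)]

/-- The density is uniformly convex on the unit ball: `density - ½ |·|²` is midpoint convex. -/
theorem density_midpoint_le (a b : R3) (ha : ‖a‖ ≤ 1) (hb : ‖b‖ ≤ 1) :
    density ((1 / 2 : ℝ) • a + (1 / 2 : ℝ) • b)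
      ≤ 1 / 2 * density a + 1 / 2 * density b - 1 / 8 * ‖a - b‖ ^ 2 := by
  have hA : 0 ≤ 1 - ‖a‖ ^ 2 := by nlinarith [norm_nonneg a]
  have hB : 0 ≤ 1 - ‖b‖ ^ 2 := by nlinarith [norm_nonneg b]
  have hp : ‖a + b‖ ^ 2 + ‖a - b‖ ^ 2 = 2 * (‖a‖ ^ 2 + ‖b‖ ^ 2) := by
    have := parallelogram_law_with_norm ℝ a b
    nlinarith
  have hm : ‖(1 / 2 : ℝ) • a + (1 / 2 : ℝ) • b‖ ^ 2 = 1 / 4 * ‖a + b‖ ^ 2 := by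
    rw [← smul_add, norm_smul, mul_pow]
    norm_num
  unfold density
  rw [hm]
  have sA := Real.sq_sqrt hA
  have sB := Real.sq_sqrt hB
  have a0 := Real.sqrt_nonneg (1 - ‖a‖ ^ 2)
  have b0 := Real.sqrt_nonneg (1 - ‖b‖ ^ 2)
  have a1 : √(1 - ‖a‖ ^ 2) ≤ 1 := Real.sqrt_le_one.2 (by nlinarith [norm_nonneg a])
  have b1 : √(1 - ‖b‖ ^ 2) ≤ 1 := Real.sqrt_le_one.2 (by nlinarith [norm_nonneg b])
  have hd0 : 0 ≤ ‖a - b‖ ^ 2 := by positivity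
  have hs0 : 0 ≤ ‖a + b‖ ^ 2 := by positivity
  generalize √(1 - ‖a‖ ^ 2) = α at *
  generalize √(1 - ‖b‖ ^ 2) = β at *
  generalize ‖a - b‖ ^ 2 = d at *
  generalize ‖a + b‖ ^ 2 = s at *
  have key : (α + β) / 2 + d / 8 ≤ √(1 - 1 / 4 * s) := by
    refine Real.le_sqrt_of_sq_le ?_
    have hd : d ≤ 2 * (2 - α ^ 2 - β ^ 2) := by linarith
    have h1 : 0 ≤ 1 / 4 - (α + β) / 8 - d / 64 := by
      nlinarith [mul_nonneg (sub_nonneg.2 a1) (sub_nonneg.2 a1),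
        mul_nonneg (sub_nonneg.2 b1) (sub_nonneg.2 b1)]
    have hs : 1 - 1 / 4 * s = (α ^ 2 + β ^ 2) / 2 + d / 4 := by linarith
    rw [hs]
    nlinarith [mul_nonneg hd0 h1, sq_nonneg (α - β)]
  linarith

theorem X_lipschitz {φ : R3 → ℝ} (h : φ ∈ X) : LipschitzWith 1 φ := by
  obtain ⟨-, ⟨K, hK⟩, h1⟩ := h
  exact lipschitzWith_one_of_gradient hK h1

theorem X_norm_gradient_le {φ : R3 → ℝ} (h : φ ∈ X) (x : R3) : ‖∇ φ x‖ ≤ 1 := by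
  rw [norm_gradient]
  exact norm_fderiv_le_of_lipschitz ℝ (X_lipschitz h)

theorem X_aestronglyMeasurable {φ : R3 → ℝ} (h : φ ∈ X) : AEStronglyMeasurable φ :=
  (X_lipschitz h).continuous.aestronglyMeasurable

theorem X_hasD12Gradient {φ : R3 → ℝ} (h : φ ∈ X) : HasD12Gradient φ (∇ φ) := by
  obtain ⟨G, hG⟩ := memD12_iff.1 h.1
  exact hG.congr (hG.ae_eq_gradient (X_lipschitz h))

theorem mem_X_of_hasD12Gradient {φ : R3 → ℝ} {G : R3 → R3} (h : HasD12Gradient φ G)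
    (hL : LipschitzWith 1 φ) : φ ∈ X := by
  refine ⟨memD12_iff.2 ⟨G, h⟩, ⟨1, hL⟩, Eventually.of_forall fun x => ?_⟩
  rw [norm_gradient]
  exact norm_fderiv_le_of_lipschitz ℝ hL

theorem zero_mem_X : (fun _ => 0) ∈ X := by
  refine mem_X_of_hasD12Gradient (G := fun _ => 0) ⟨fun _ _ => 0, fun _ => ⟨contDiff_const, ?_⟩,
    MemLp.zero, ?_, ?_⟩ (LipschitzWith.const' 0)
  · exact HasCompactSupport.zero
  · have : ∀ x : R3, ∇ (fun _ : R3 => (0 : ℝ)) x = 0 := fun x => by simp [gradient]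
    simp [this]
  · simp

theorem X_memLp_six {φ : R3 → ℝ} (h : φ ∈ X) : MemLp φ 6 :=
  (X_hasD12Gradient h).memLp (X_aestronglyMeasurable h)

theorem X_memLp_gradient {φ : R3 → ℝ} (h : φ ∈ X) : MemLp (∇ φ) 2 :=
  (X_hasD12Gradient h).memLp_gradient

theorem X_integrable_density {φ : R3 → ℝ} (h : φ ∈ X) : Integrable (fun x => density (∇ φ x)) := by
  refine ((X_memLp_gradient h).integrable_norm_pow two_ne_zero).mono'
    (continuous_density.comp_aestronglyMeasurable (X_memLp_gradient h).1)
    (Eventually.of_forall fun x => ?_)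
  rw [Real.norm_of_nonneg (density_nonneg _)]
  exact density_le _ (X_norm_gradient_le h x)

/-- The midpoint of two elements of `𝒳`. -/
theorem X_midpoint {φ χ : R3 → ℝ} (hφ : φ ∈ X) (hχ : χ ∈ X) :
    (fun x => 1 / 2 * φ x + 1 / 2 * χ x) ∈ X := by
  refine mem_X_of_hasD12Gradient ((X_hasD12Gradient hφ).combo (X_hasD12Gradient hχ)
    (X_aestronglyMeasurable hφ) (X_aestronglyMeasurable hχ) (1 / 2) (1 / 2)) ?_
  refine LipschitzWith.of_dist_le_mul fun x y => ?_
  have h1 := (X_lipschitz hφ).dist_le_mul x y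
  have h2 := (X_lipschitz hχ).dist_le_mul x y
  rw [NNReal.coe_one, one_mul, Real.dist_eq] at *
  have e : 1 / 2 * φ x + 1 / 2 * χ x - (1 / 2 * φ y + 1 / 2 * χ y)
      = 1 / 2 * (φ x - φ y) + 1 / 2 * (χ x - χ y) := by ring
  rw [e]
  refine (abs_add_le _ _).trans ?_
  rw [abs_mul, abs_mul, abs_of_pos (by norm_num : (0 : ℝ) < 1 / 2)]
  linarith

/-- An element of `𝒳` as an element of `L⁶`. -/
noncomputable def toL6 (φ : X) : Lp ℝ 6 (volume : Measure R3) := (X_memLp_six φ.2).toLp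

/-- The gradient of an element of `𝒳` as an element of `L²`. -/
noncomputable def toGrad (φ : X) : Lp R3 2 (volume : Measure R3) := (X_memLp_gradient φ.2).toLp

/-- The Born–Infeld energy `∫ (1 - √(1 - |∇φ|²))`. -/
noncomputable def energy (φ : X) : ℝ := ∫ x, density (∇ φ.1 x)

theorem coeFn_toL6 (φ : X) : toL6 φ =ᵐ[volume] φ.1 := MemLp.coeFn_toLp _

theorem coeFn_toGrad (φ : X) : toGrad φ =ᵐ[volume] ∇ φ.1 := MemLp.coeFn_toLp _

theorem energy_nonneg (φ : X) : 0 ≤ energy φ := integral_nonneg fun _ => density_nonneg _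

theorem norm_sq_eq_integral (f : Lp R3 2 (volume : Measure R3)) : ‖f‖ ^ 2 = ∫ x, ‖f x‖ ^ 2 := by
  rw [← real_inner_self_eq_norm_sq, L2.inner_def]
  simp

theorem integrable_norm_sq (f : Lp R3 2 (volume : Measure R3)) :
    Integrable (fun x => ‖f x‖ ^ 2) :=
  (Lp.memLp f).integrable_norm_pow two_ne_zero

theorem half_norm_sq_le_energy (φ : X) : 1 / 2 * ‖toGrad φ‖ ^ 2 ≤ energy φ := by
  rw [norm_sq_eq_integral, ← integral_const_mul]
  refine integral_mono_ae ((integrable_norm_sq _).const_mul _) (X_integrable_density φ.2) ?_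
  filter_upwards [coeFn_toGrad φ] with x hx
  rw [hx]
  exact half_sq_le_density _ (X_norm_gradient_le φ.2 x)

/-- The Sobolev inequality on `𝒳`. -/
theorem norm_toL6_sub_le (φ χ : X) :
    ‖toL6 φ - toL6 χ‖ ≤ sobolevConst * ‖toGrad φ - toGrad χ‖ := by
  have h := ((X_hasD12Gradient φ.2).combo (X_hasD12Gradient χ.2)
    (X_aestronglyMeasurable φ.2) (X_aestronglyMeasurable χ.2) 1 (-1))
  have hs := h.sobolev (((X_aestronglyMeasurable φ.2).const_mul 1).add
    ((X_aestronglyMeasurable χ.2).const_mul (-1)))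
  have e1 : eLpNorm (fun x => 1 * φ.1 x + -1 * χ.1 x) 6 = eLpNorm (toL6 φ - toL6 χ : Lp ℝ 6 _) 6 := by
    refine eLpNorm_congr_ae ?_
    filter_upwards [coeFn_toL6 φ, coeFn_toL6 χ, Lp.coeFn_sub (toL6 φ) (toL6 χ)] with x h1 h2 h3
    rw [h3, Pi.sub_apply, h1, h2]
    ring
  have e2 : eLpNorm (fun x => (1 : ℝ) • ∇ φ.1 x + (-1 : ℝ) • ∇ χ.1 x) 2
      = eLpNorm (toGrad φ - toGrad χ : Lp R3 2 _) 2 := by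
    refine eLpNorm_congr_ae ?_
    filter_upwards [coeFn_toGrad φ, coeFn_toGrad χ, Lp.coeFn_sub (toGrad φ) (toGrad χ)]
      with x h1 h2 h3
    rw [h3, Pi.sub_apply, h1, h2, one_smul, neg_one_smul, sub_eq_add_neg]
  rw [e1, e2] at hs
  rw [Lp.norm_def, Lp.norm_def, ← ENNReal.coe_toReal, ← ENNReal.toReal_mul]
  exact ENNReal.toReal_mono (ENNReal.mul_ne_top ENNReal.coe_ne_top (Lp.eLpNorm_ne_top _)) hs

/-- Uniform convexity of the energy in the `D^{1,2}` norm. -/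
theorem exists_midpoint (φ χ : X) : ∃ m : X,
    toL6 m = (1 / 2 : ℝ) • toL6 φ + (1 / 2 : ℝ) • toL6 χ ∧
    energy m ≤ 1 / 2 * energy φ + 1 / 2 * energy χ - 1 / 8 * ‖toGrad φ - toGrad χ‖ ^ 2 := by
  refine ⟨⟨_, X_midpoint φ.2 χ.2⟩, ?_, ?_⟩
  · refine Lp.ext ?_
    filter_upwards [coeFn_toL6 ⟨_, X_midpoint φ.2 χ.2⟩, coeFn_toL6 φ, coeFn_toL6 χ,
      Lp.coeFn_add ((1 / 2 : ℝ) • toL6 φ) ((1 / 2 : ℝ) • toL6 χ),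
      Lp.coeFn_smul (1 / 2 : ℝ) (toL6 φ), Lp.coeFn_smul (1 / 2 : ℝ) (toL6 χ)]
      with x h1 h2 h3 h4 h5 h6
    rw [h1, h4, Pi.add_apply, h5, h6, Pi.smul_apply, Pi.smul_apply, h2, h3]
    rfl
  · have iφ := (X_integrable_density φ.2).const_mul (1 / 2)
    have iχ := (X_integrable_density χ.2).const_mul (1 / 2)
    have iD := (integrable_norm_sq (toGrad φ - toGrad χ)).const_mul (1 / 8)
    have e : 1 / 2 * energy φ + 1 / 2 * energy χ - 1 / 8 * ‖toGrad φ - toGrad χ‖ ^ 2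
        = ∫ x, (1 / 2 * density (∇ φ.1 x) + 1 / 2 * density (∇ χ.1 x)
          - 1 / 8 * ‖(toGrad φ - toGrad χ : Lp R3 2 volume) x‖ ^ 2) := by
      have i1 := integral_sub (iφ.add iχ) iD
      simp only [Pi.add_apply] at i1
      rw [i1, integral_add iφ iχ, integral_const_mul, integral_const_mul, integral_const_mul,
        norm_sq_eq_integral]
      rfl
    rw [e]
    refine integral_mono_ae (X_integrable_density (X_midpoint φ.2 χ.2)) ((iφ.add iχ).sub iD) ?_
    filter_upwards [coeFn_toGrad φ, coeFn_toGrad χ, Lp.coeFn_sub (toGrad φ) (toGrad χ),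
      (X_lipschitz φ.2).ae_differentiableAt (μ := volume),
      (X_lipschitz χ.2).ae_differentiableAt (μ := volume)] with x h1 h2 h3 h4 h5
    rw [gradient_combo h4 h5, h3, Pi.sub_apply, h1, h2]
    exact density_midpoint_le _ _ (X_norm_gradient_le φ.2 x) (X_norm_gradient_le χ.2 x)

theorem tendsto_eLpNorm_sub {F : Type*} [NormedAddCommGroup F] {q : ℝ≥0∞} [Fact (1 ≤ q)]
    {f : ℕ → Lp F q (volume : Measure R3)} {f' : Lp F q (volume : Measure R3)}
    (h : Tendsto f atTop (𝓝 f')) {g : ℕ → R3 → F} {g' : R3 → F} (hg : ∀ n, f n =ᵐ[volume] g n)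
    (hg' : f' =ᵐ[volume] g') : Tendsto (fun n => eLpNorm (fun x => g n x - g' x) q) atTop (𝓝 0) := by
  refine ((Lp.tendsto_Lp_iff_tendsto_eLpNorm' f f').1 h).congr fun n => eLpNorm_congr_ae ?_
  filter_upwards [hg n, hg'] with x h1 h2
  rw [Pi.sub_apply, h1, h2]

/-- `𝒳` is complete for the `D^{1,2}` norm: a limit in `L⁶` of `1`-Lipschitz functions has a
`1`-Lipschitz representative. -/
theorem exists_tendsto_toGrad {φ : ℕ → X} (h : CauchySeq fun n => toGrad (φ n)) :
    ∃ χ : X, Tendsto (fun n => toGrad (φ n)) atTop (𝓝 (toGrad χ)) := by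
  have h6 : CauchySeq fun n => toL6 (φ n) := by
    rw [Metric.cauchySeq_iff'] at h ⊢
    intro ε hε
    obtain ⟨N, hN⟩ := h (ε / (sobolevConst + 1)) (by positivity)
    refine ⟨N, fun n hn => ?_⟩
    have h1 := hN n hn
    rw [dist_eq_norm, lt_div_iff₀ (by positivity)] at h1
    rw [dist_eq_norm]
    refine (norm_toL6_sub_le _ _).trans_lt ?_
    nlinarith [norm_nonneg (toGrad (φ n) - toGrad (φ N))]
  obtain ⟨G, hG⟩ := cauchySeq_tendsto_of_complete h
  obtain ⟨f, hf⟩ := cauchySeq_tendsto_of_complete h6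
  obtain ⟨ns, -, hns⟩ := (tendstoInMeasure_of_tendsto_Lp hf).exists_seq_tendsto_ae
  have hae : ∀ᵐ x, Tendsto (fun k => (φ (ns k)).1 x) atTop (𝓝 (f x)) := by
    have hall : ∀ᵐ x, ∀ n, toL6 (φ n) x = (φ n).1 x := ae_all_iff.2 fun n => coeFn_toL6 (φ n)
    filter_upwards [hns, hall] with x h1 h2
    simpa only [h2] using h1
  let s : Set R3 := {x | Tendsto (fun k => (φ (ns k)).1 x) atTop (𝓝 (f x))}
  have hs : LipschitzOnWith 1 f s := by
    refine LipschitzOnWith.of_dist_le_mul fun x hx y hy => ?_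
    exact le_of_tendsto (hx.dist hy)
      (Eventually.of_forall fun k => (X_lipschitz (φ (ns k)).2).dist_le_mul x y)
  obtain ⟨g, hg, hgs⟩ := hs.extend_real
  have hfg : f =ᵐ[volume] g := by
    filter_upwards [hae] with x hx
    exact hgs hx
  have hD : HasD12Gradient g G := HasD12Gradient.of_tendsto (fun n => X_hasD12Gradient (φ n).2)
    (fun n => X_aestronglyMeasurable (φ n).2) hg.continuous.aestronglyMeasurable (Lp.memLp G)
    (tendsto_eLpNorm_sub hG (fun n => coeFn_toGrad (φ n)) EventuallyEq.rfl)
    (tendsto_eLpNorm_sub hf (fun n => coeFn_toL6 (φ n)) hfg)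
  refine ⟨⟨g, mem_X_of_hasD12Gradient hD hg⟩, ?_⟩
  convert hG
  refine Lp.ext ?_
  exact (coeFn_toGrad _).trans (hD.ae_eq_gradient hg).symm

theorem eLpNorm_density (φ : X) :
    eLpNorm (fun x => density (∇ φ.1 x)) 1 = ENNReal.ofReal (energy φ) := by
  rw [eLpNorm_one_eq_lintegral_enorm, energy,
    ofReal_integral_eq_lintegral_ofReal (X_integrable_density φ.2)
      (Eventually.of_forall fun _ => density_nonneg _)]
  simp only [Real.enorm_of_nonneg (density_nonneg _)]

/-- Lower semicontinuity of the energy, by Fatou's lemma. -/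
theorem energy_le_of_tendsto {φ : ℕ → X} {χ : X}
    (h : Tendsto (fun n => toGrad (φ n)) atTop (𝓝 (toGrad χ))) {c : ℕ → ℝ} {c' : ℝ}
    (hc : ∀ n, energy (φ n) ≤ c n) (hc' : Tendsto c atTop (𝓝 c')) : energy χ ≤ c' := by
  obtain ⟨ns, hmono, hns⟩ := (tendstoInMeasure_of_tendsto_Lp h).exists_seq_tendsto_ae
  have hall : ∀ᵐ x, ∀ n, toGrad (φ n) x = ∇ (φ n).1 x := ae_all_iff.2 fun n => coeFn_toGrad (φ n)
  have hae : ∀ᵐ x, Tendsto (fun k => density (∇ (φ (ns k)).1 x)) atTop (𝓝 (density (∇ χ.1 x))) := by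
    filter_upwards [hns, hall, coeFn_toGrad χ] with x h1 h2 h3
    simp only [h2, h3] at h1
    exact (continuous_density.tendsto _).comp h1
  have h1 := eLpNorm_le_of_ae_tendsto (q := 1)
    (fun k => (X_integrable_density (φ (ns k)).2).1) hae
    (b := fun k => ENNReal.ofReal (c (ns k))) (fun k => by
      rw [eLpNorm_density]
      exact ENNReal.ofReal_le_ofReal (hc _))
    (ENNReal.tendsto_ofReal (hc'.comp hmono.tendsto_atTop))
  rw [eLpNorm_density] at h1
  have h0 : 0 ≤ c' := ge_of_tendsto' hc' fun n => (energy_nonneg _).trans (hc n)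
  exact (ENNReal.ofReal_le_ofReal_iff h0).1 h1

/-- Elements of `𝒳` are determined by their gradients. -/
theorem eq_of_toGrad_eq {φ χ : X} (h : toGrad φ = toGrad χ) : φ = χ := by
  have h1 := norm_toL6_sub_le φ χ
  rw [h, sub_self, norm_zero, mul_zero] at h1
  have h2 : toL6 φ = toL6 χ := sub_eq_zero.1 (norm_le_zero_iff.1 h1)
  refine Subtype.ext ?_
  have h3 : φ.1 =ᵐ[volume] χ.1 := by
    refine (coeFn_toL6 φ).symm.trans ?_
    rw [h2]
    exact coeFn_toL6 χ
  exact Measure.eq_of_ae_eq h3 (X_lipschitz φ.2).continuous (X_lipschitz χ.2).continuous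

/-! ### A criterion for continuous differentiability -/

/-- A function with a continuous family of supporting paraboloids from above is `C¹`: exchanging
the roles of the two points turns the upper bound into a matching lower bound. -/
theorem hasFDerivAt_of_le_quadratic {V : Type*} [NormedAddCommGroup V] [NormedSpace ℝ V]
    {f : V → ℝ} {D : V → V →L[ℝ] ℝ} {r : V → ℝ} (hD : Continuous D) (hr : Continuous r)
    (h : ∀ u v, f v - f u ≤ D u (v - u) + r u * ‖v - u‖ ^ 2) (u : V) :
    HasFDerivAt f (D u) u := by
  refine HasFDerivAt.of_isLittleO (Asymptotics.isLittleO_iff.2 fun c hc => ?_)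
  have hcont : Continuous fun v => ‖D v - D u‖ + (|r u| + |r v|) * ‖v - u‖ := by fun_prop
  have ht := hcont.tendsto u
  simp only [sub_self, norm_zero, mul_zero, add_zero] at ht
  filter_upwards [ht.eventually (gt_mem_nhds hc)] with v hv
  have hn := norm_nonneg (v - u)
  have h1 := h u v
  have h2 := h v u
  have h3 : D v (u - v) = -D v (v - u) := by rw [← map_neg, neg_sub]
  rw [h3, norm_sub_rev] at h2
  have h4 : |D v (v - u) - D u (v - u)| ≤ ‖D v - D u‖ * ‖v - u‖ := (D v - D u).le_opNorm (v - u)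
  have h5 : |f v - f u - D u (v - u)|
      ≤ (‖D v - D u‖ + (|r u| + |r v|) * ‖v - u‖) * ‖v - u‖ := by
    have a1 : r u * ‖v - u‖ ^ 2 ≤ |r u| * ‖v - u‖ ^ 2 := by gcongr; exact le_abs_self _
    have a2 : r v * ‖v - u‖ ^ 2 ≤ |r v| * ‖v - u‖ ^ 2 := by gcongr; exact le_abs_self _
    have a3 : 0 ≤ |r u| * ‖v - u‖ ^ 2 := by positivity
    have a4 : 0 ≤ |r v| * ‖v - u‖ ^ 2 := by positivity
    have a5 := abs_le.1 h4
    have a6 : 0 ≤ ‖D v - D u‖ * ‖v - u‖ := by positivity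
    have e : (‖D v - D u‖ + (|r u| + |r v|) * ‖v - u‖) * ‖v - u‖
      = ‖D v - D u‖ * ‖v - u‖ + |r u| * ‖v - u‖ ^ 2 + |r v| * ‖v - u‖ ^ 2 := by ring
    rw [e, abs_le]
    constructor <;> linarith [a5.1, a5.2]
  exact h5.trans (mul_le_mul_of_nonneg_right hv.le hn)

theorem contDiff_one_of_le_quadratic {V : Type*} [NormedAddCommGroup V] [NormedSpace ℝ V]
    {f : V → ℝ} {D : V → V →L[ℝ] ℝ} {r : V → ℝ} (hD : Continuous D) (hr : Continuous r)
    (h : ∀ u v, f v - f u ≤ D u (v - u) + r u * ‖v - u‖ ^ 2) : ContDiff ℝ 1 f := by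
  have hd := hasFDerivAt_of_le_quadratic hD hr h
  refine contDiff_one_iff_fderiv.2 ⟨fun u => (hd u).differentiableAt, ?_⟩
  rwa [funext fun u => (hd u).fderiv]

instance : Fact ((1 : ℝ≥0∞) ≤ ENNReal.ofReal 3) := ⟨by simp⟩

instance : ENNReal.HolderTriple 6 (ENNReal.ofReal 3) 2 where
  inv_add_inv_eq_inv := by
    rw [ENNReal.ofReal_ofNat, ← ENNReal.toReal_eq_toReal_iff' (by simp) (by simp),
      ENNReal.toReal_add (by simp) (by simp)]
    norm_num

section Coupling

variable {V : Type*} [NormedAddCommGroup V] [NormedSpace ℝ V]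

/-- The continuous trilinear form `(φ, u, v) ↦ ∫ φ u v` on `L⁶ × V × V`, for a normed space `V`
embedded in `L³` by `a` and in `L²` by `b`. It is continuous by Hölder's inequality with
`φ ∈ L⁶`, `u ∈ L³`, `v ∈ L²`. -/
noncomputable def coupling (a : V →L[ℝ] Lp ℝ (ENNReal.ofReal 3) (volume : Measure R3))
    (b : V →L[ℝ] Lp ℝ 2 (volume : Measure R3)) :
    Lp ℝ 6 (volume : Measure R3) →L[ℝ] V →L[ℝ] V →L[ℝ] ℝ :=
  let A : Lp ℝ 6 (volume : Measure R3) →L[ℝ] Lp ℝ (ENNReal.ofReal 3) (volume : Measure R3) →L[ℝ]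
      Lp ℝ 2 (volume : Measure R3) :=
    (ContinuousLinearMap.mul ℝ ℝ).holderL volume 6 (ENNReal.ofReal 3) 2
  let P : Lp ℝ 2 (volume : Measure R3) →L[ℝ] Lp ℝ 2 (volume : Measure R3) →L[ℝ] ℝ :=
    (ContinuousLinearMap.mul ℝ ℝ).lpPairing volume 2 2
  let Q : Lp ℝ 2 (volume : Measure R3) →L[ℝ] V →L[ℝ] ℝ :=
    ((ContinuousLinearMap.compL ℝ V (Lp ℝ 2 (volume : Measure R3)) ℝ).flip b).comp P
  let A' : Lp ℝ 6 (volume : Measure R3) →L[ℝ] V →L[ℝ] Lp ℝ 2 (volume : Measure R3) :=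
    ((ContinuousLinearMap.compL ℝ V (Lp ℝ (ENNReal.ofReal 3) (volume : Measure R3))
      (Lp ℝ 2 (volume : Measure R3))).flip a).comp A
  (ContinuousLinearMap.compL ℝ V (Lp ℝ 2 (volume : Measure R3)) (V →L[ℝ] ℝ) Q).comp A'

theorem coupling_apply (a : V →L[ℝ] Lp ℝ (ENNReal.ofReal 3) (volume : Measure R3))
    (b : V →L[ℝ] Lp ℝ 2 (volume : Measure R3)) {f : Lp ℝ 6 (volume : Measure R3)}
    {φ s t : R3 → ℝ} {u v : V} (hf : f =ᵐ[volume] φ) (hu : a u =ᵐ[volume] s)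
    (hv : b v =ᵐ[volume] t) : coupling a b f u v = ∫ x, φ x * s x * t x := by
  have h : coupling a b f u v = ∫ x, (ContinuousLinearMap.mul ℝ ℝ)
      (((ContinuousLinearMap.mul ℝ ℝ).holder 2 f (a u) : Lp ℝ 2 (volume : Measure R3)) x)
      (b v x) :=
    ContinuousLinearMap.lpPairing_eq_integral (ContinuousLinearMap.mul ℝ ℝ)
      ((ContinuousLinearMap.mul ℝ ℝ).holder 2 f (a u)) (b v)
  rw [h]
  refine integral_congr_ae ?_
  filter_upwards [(ContinuousLinearMap.mul ℝ ℝ).coeFn_holder (r := 2) f (a u), hf, hu, hv]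
    with x h1 h2 h3 h4
  rw [h1, ContinuousLinearMap.mul_apply', ContinuousLinearMap.mul_apply', h2, h3, h4]

theorem integrable_mul_mul {φ s t : R3 → ℝ} (hφ : MemLp φ 6) (hs : MemLp s (ENNReal.ofReal 3))
    (ht : MemLp t 2) : Integrable fun x => φ x * s x * t x :=
  MemLp.integrable_mul (p := 2) (q := 2) (hs.mul hφ) ht

end Coupling

/-! ### Minimization over `𝒳` -/

section Minimizer

variable {V : Type*} [NormedAddCommGroup V] [NormedSpace ℝ V]

/-- A family of symmetric bilinear forms on `V`, affine and Lipschitz continuous in the parameter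
`φ ∈ 𝒳` with its `D^{1,2}` norm. The model is `(u, v) ↦ ∫ φ u v`. -/
structure Coupling (V : Type*) [NormedAddCommGroup V] [NormedSpace ℝ V] where
  /-- The bilinear form attached to `φ`. -/
  form : X → V →L[ℝ] V →L[ℝ] ℝ
  /-- A Lipschitz constant in `φ`. -/
  const : ℝ
  const_nonneg : 0 ≤ const
  norm_sub_le : ∀ φ χ, ‖form φ - form χ‖ ≤ const * ‖toGrad φ - toGrad χ‖
  midpoint : ∀ φ χ m : X, toL6 m = (1 / 2 : ℝ) • toL6 φ + (1 / 2 : ℝ) • toL6 χ →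
    ∀ u, form m u u = 1 / 2 * form φ u u + 1 / 2 * form χ u u
  symm : ∀ φ u v, form φ u v = form φ v u

/-- The functional `φ ↦ energy φ - B_φ(u, u)` on `𝒳`. -/
noncomputable def action (B : Coupling V) (u : V) (φ : X) : ℝ := energy φ - B.form φ u u

variable {B : Coupling V}

theorem Coupling.form_diff_sq (B : Coupling V) (φ : X) (u v : V) :
    B.form φ v v - B.form φ u u = 2 * B.form φ u (v - u) + B.form φ (v - u) (v - u) := by
  simp only [map_sub, sub_apply]
  rw [B.symm φ v u]
  ring

theorem Coupling.abs_sub_le (B : Coupling V) (φ χ : X) (u v : V) :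
    |B.form φ u v - B.form χ u v| ≤ B.const * ‖toGrad φ - toGrad χ‖ * ‖u‖ * ‖v‖ :=
  ((B.form φ - B.form χ).le_opNorm₂ u v).trans (by gcongr; exact B.norm_sub_le φ χ)

theorem norm_sq_toGrad_sub_le_of_lower_bound {u : V} {i : ℝ} (hi : ∀ χ, i ≤ action B u χ)
    (φ χ : X) :
    1 / 4 * ‖toGrad φ - toGrad χ‖ ^ 2 ≤ (action B u φ - i) + (action B u χ - i) := by
  obtain ⟨m, h6, hm⟩ := exists_midpoint φ χ
  have h1 := hi m
  have h2 := B.midpoint φ χ m h6 u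
  unfold action at *
  linarith

theorem exists_lower_bound (B : Coupling V) (u : V) : ∃ C, ∀ φ, C ≤ action B u φ := by
  let o : X := ⟨_, zero_mem_X⟩
  set c := B.const * ‖u‖ * ‖u‖ with hc
  have hc0 : 0 ≤ c := mul_nonneg (mul_nonneg B.const_nonneg (norm_nonneg u)) (norm_nonneg u)
  refine ⟨-(B.form o u u) - c * ‖toGrad o‖ - 1 / 2 * c ^ 2, fun φ => ?_⟩
  have h1 := (abs_le.1 (B.abs_sub_le φ o u u)).2
  have h2 := half_norm_sq_le_energy φ
  have h3 := mul_le_mul_of_nonneg_left (norm_sub_le (toGrad φ) (toGrad o)) hc0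
  have e : B.const * ‖toGrad φ - toGrad o‖ * ‖u‖ * ‖u‖ = c * ‖toGrad φ - toGrad o‖ := by
    rw [hc]
    ring
  rw [e] at h1
  unfold action
  nlinarith [sq_nonneg (‖toGrad φ‖ - c)]

/-- Existence of a minimizer by the direct method. By uniform convexity, a minimizing sequence is a
Cauchy sequence for the `D^{1,2}` norm, so no weak compactness is needed. -/
theorem exists_action_minimizer (B : Coupling V) (u : V) : ∃ φ, ∀ χ, action B u φ ≤ action B u χ := by
  obtain ⟨C, hC⟩ := exists_lower_bound B u
  have hne : (Set.range (action B u)).Nonempty := ⟨_, ⟨⟨_, zero_mem_X⟩, rfl⟩⟩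
  have hbd : BddBelow (Set.range (action B u)) := ⟨C, by rintro _ ⟨φ, rfl⟩; exact hC φ⟩
  set i := sInf (Set.range (action B u)) with hi_def
  have hi : ∀ χ, i ≤ action B u χ := fun χ => csInf_le hbd ⟨χ, rfl⟩
  have hex : ∀ n : ℕ, ∃ φ, action B u φ < i + 1 / ((n : ℝ) + 1) := by
    intro n
    obtain ⟨_, ⟨φ, rfl⟩, h⟩ := exists_lt_of_csInf_lt hne
      (lt_add_of_pos_right i (by positivity : (0 : ℝ) < 1 / ((n : ℝ) + 1)))
    exact ⟨φ, h⟩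
  choose φ hφ using hex
  have hlim := tendsto_one_div_add_atTop_nhds_zero_nat (𝕜 := ℝ)
  have hcau : CauchySeq fun n => toGrad (φ n) := by
    refine cauchySeq_of_le_tendsto_0 (fun N : ℕ => √(8 * (1 / ((N : ℝ) + 1)))) (fun n m N hn hm => ?_)
      ?_
    · rw [dist_eq_norm]
      refine Real.le_sqrt_of_sq_le ?_
      have h1 := norm_sq_toGrad_sub_le_of_lower_bound hi (φ n) (φ m)
      have h2 : 1 / ((n : ℝ) + 1) ≤ 1 / ((N : ℝ) + 1) := by gcongr
      have h3 : 1 / ((m : ℝ) + 1) ≤ 1 / ((N : ℝ) + 1) := by gcongr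
      linarith [hφ n, hφ m]
    · have := (hlim.const_mul 8).sqrt
      simpa using this
  obtain ⟨χ, hχ⟩ := exists_tendsto_toGrad hcau
  have hB : Tendsto (fun n => B.form (φ n) u u) atTop (𝓝 (B.form χ u u)) := by
    rw [tendsto_iff_norm_sub_tendsto_zero] at hχ ⊢
    refine squeeze_zero (fun _ => norm_nonneg _) (fun n => B.abs_sub_le (φ n) χ u u) ?_
    simpa using ((hχ.const_mul B.const).mul_const ‖u‖).mul_const ‖u‖
  have hen : energy χ ≤ i + 0 + B.form χ u u := by
    refine energy_le_of_tendsto hχ (c := fun n : ℕ => i + 1 / ((n : ℝ) + 1) + B.form (φ n) u u)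
      (fun n => ?_) ((hlim.const_add i).add hB)
    have := (hφ n).le
    unfold action at this
    linarith
  refine ⟨χ, fun η => le_trans ?_ (hi η)⟩
  unfold action
  linarith

/-- The quadratic growth of the functional away from its minimizer. -/
theorem norm_sq_toGrad_sub_minimizer_le {u : V} {φ : X} (h : ∀ χ, action B u φ ≤ action B u χ)
    (χ : X) : 1 / 4 * ‖toGrad χ - toGrad φ‖ ^ 2 ≤ action B u χ - action B u φ := by
  have := norm_sq_toGrad_sub_le_of_lower_bound h χ φ
  linarith

theorem action_minimizer_unique {u : V} {φ χ : X} (hφ : ∀ η, action B u φ ≤ action B u η)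
    (hχ : ∀ η, action B u χ ≤ action B u η) : χ = φ := by
  have h1 := norm_sq_toGrad_sub_minimizer_le hφ χ
  have h2 := hχ φ
  have h3 : ‖toGrad χ - toGrad φ‖ ^ 2 = 0 := by
    nlinarith [sq_nonneg ‖toGrad χ - toGrad φ‖]
  exact eq_of_toGrad_eq (sub_eq_zero.1 (norm_eq_zero.1 (pow_eq_zero_iff two_ne_zero |>.1 h3)))

variable {m : V → X}

/-- The minimizer depends on `u` in a locally Lipschitz way: add up the quadratic growth estimates
at `u` and at `w`. -/
theorem norm_toGrad_minimizer_sub_le (hm : ∀ u χ, action B u (m u) ≤ action B u χ) (u w : V) :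
    ‖toGrad (m w) - toGrad (m u)‖ ≤ 2 * B.const * ‖w - u‖ * ‖w + u‖ := by
  have h1 := norm_sq_toGrad_sub_minimizer_le (hm u) (m w)
  have h2 := norm_sq_toGrad_sub_minimizer_le (hm w) (m u)
  rw [norm_sub_rev] at h2
  have h3 := (abs_le.1 (B.abs_sub_le (m w) (m u) (w - u) (w + u))).2
  have e : action B u (m w) - action B u (m u) + (action B w (m u) - action B w (m w))
      = B.form (m w) (w - u) (w + u) - B.form (m u) (w - u) (w + u) := by
    unfold action
    simp only [map_sub, map_add, sub_apply]
    rw [B.symm _ w u, B.symm _ w u]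
    ring
  set g := ‖toGrad (m w) - toGrad (m u)‖ with hg
  have hg0 : 0 ≤ g := norm_nonneg _
  have hk0 : 0 ≤ 2 * B.const * ‖w - u‖ * ‖w + u‖ := by
    have := B.const_nonneg
    positivity
  rcases hg0.eq_or_lt with h0 | h0
  · rwa [← h0]
  · have : g * g ≤ (2 * B.const * ‖w - u‖ * ‖w + u‖) * g := by nlinarith
    exact le_of_mul_le_mul_right this h0

theorem continuous_form_minimizer (hm : ∀ u χ, action B u (m u) ≤ action B u χ) :
    Continuous fun u => B.form (m u) := by
  refine continuous_iff_continuousAt.2 fun u => ?_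
  refine (tendsto_iff_norm_sub_tendsto_zero (E := V →L[ℝ] V →L[ℝ] ℝ)).2 ?_
  refine squeeze_zero (fun w => norm_nonneg (B.form (m w) - B.form (m u)))
    (fun w => (B.norm_sub_le (m w) (m u)).trans
    (mul_le_mul_of_nonneg_left (norm_toGrad_minimizer_sub_le hm u w) B.const_nonneg)) ?_
  have hc : Continuous fun w => B.const * (2 * B.const * ‖w - u‖ * ‖w + u‖) := by fun_prop
  simpa using hc.tendsto u

/-- The minimal value is bounded from above by the value at the minimizer of another point; the
bound is quadratic in the increment. -/
theorem action_minimizer_sub_le (hm : ∀ u χ, action B u (m u) ≤ action B u χ) (u v : V) :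
    action B v (m v) - action B u (m u)
      ≤ ((-2 : ℝ) • B.form (m u) u) (v - u) + ‖B.form (m u)‖ * ‖v - u‖ ^ 2 := by
  have h1 := hm v (m u)
  have h2 := B.form_diff_sq (m u) u v
  have h3 := (abs_le.1 ((B.form (m u)).le_opNorm₂ (v - u) (v - u))).1
  have e : action B v (m u) - action B u (m u)
      = -(B.form (m u) v v - B.form (m u) u u) := by
    unfold action
    ring
  have e2 : ((-2 : ℝ) • B.form (m u) u) (v - u) = -2 * B.form (m u) u (v - u) := rfl
  rw [e2]
  nlinarith

theorem continuous_form_minimizer_apply (hm : ∀ u χ, action B u (m u) ≤ action B u χ) :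
    Continuous fun u => (-2 : ℝ) • B.form (m u) u :=
  ((continuous_form_minimizer hm).clm_apply continuous_id).const_smul (-2 : ℝ)

theorem contDiff_action_minimizer (hm : ∀ u χ, action B u (m u) ≤ action B u χ) :
    ContDiff ℝ 1 fun u => action B u (m u) :=
  contDiff_one_of_le_quadratic (continuous_form_minimizer_apply hm)
    (r := fun u => ‖B.form (m u)‖) ((continuous_norm (E := V →L[ℝ] V →L[ℝ] ℝ)).comp (continuous_form_minimizer hm))
    (action_minimizer_sub_le hm)

/-- The envelope theorem: the minimal value has the derivative of the functional at the fixed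
minimizer. -/
theorem hasFDerivAt_action_minimizer (hm : ∀ u χ, action B u (m u) ≤ action B u χ) (u : V) :
    HasFDerivAt (fun u => action B u (m u)) ((-2 : ℝ) • B.form (m u) u) u :=
  hasFDerivAt_of_le_quadratic (continuous_form_minimizer_apply hm)
    (r := fun u => ‖B.form (m u)‖) ((continuous_norm (E := V →L[ℝ] V →L[ℝ] ℝ)).comp (continuous_form_minimizer hm))
    (action_minimizer_sub_le hm) u

end Minimizer

section MulCoupling

variable {V : Type*} [NormedAddCommGroup V] [NormedSpace ℝ V]

theorem coupling_apply_eq_inner (a : V →L[ℝ] Lp ℝ (ENNReal.ofReal 3) (volume : Measure R3))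
    (b : V →L[ℝ] Lp ℝ 2 (volume : Measure R3)) (f : Lp ℝ 6 (volume : Measure R3)) (u v : V) :
    coupling a b f u v = inner ℝ (b v) ((ContinuousLinearMap.mul ℝ ℝ).holder 2 f (a u)) := by
  rw [L2.inner_def]
  exact ContinuousLinearMap.lpPairing_eq_integral (ContinuousLinearMap.mul ℝ ℝ)
      ((ContinuousLinearMap.mul ℝ ℝ).holder 2 f (a u)) (b v)

theorem norm_coupling_le (a : V →L[ℝ] Lp ℝ (ENNReal.ofReal 3) (volume : Measure R3))
    (b : V →L[ℝ] Lp ℝ 2 (volume : Measure R3)) {A B : ℝ} (ha : ∀ u, ‖a u‖ ≤ A * ‖u‖)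
    (hb : ∀ u, ‖b u‖ ≤ B * ‖u‖) (hB : 0 ≤ B)
    (f : Lp ℝ 6 (volume : Measure R3)) (u v : V) :
    ‖coupling a b f u v‖ ≤ A * B * ‖f‖ * ‖u‖ * ‖v‖ := by
  rw [coupling_apply_eq_inner]
  refine (norm_inner_le_norm _ _).trans ?_
  have h1 := (ContinuousLinearMap.mul ℝ ℝ).norm_holder_apply_apply_le (r := 2) f (a u)
  rw [ContinuousLinearMap.opNorm_mul, one_mul] at h1
  calc _ ≤ (B * ‖v‖) * (‖f‖ * (A * ‖u‖)) :=
        mul_le_mul (hb v) (h1.trans (by gcongr; exact ha u)) (norm_nonneg _) (by positivity)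
    _ = _ := by ring

/-- The coupling `(u, v) ↦ ∫ φ u v` as a family of bilinear forms indexed by `𝒳`. -/
noncomputable def mulCoupling (a : V →L[ℝ] Lp ℝ (ENNReal.ofReal 3) (volume : Measure R3))
    (b : V →L[ℝ] Lp ℝ 2 (volume : Measure R3)) {A B : ℝ} (ha : ∀ u, ‖a u‖ ≤ A * ‖u‖)
    (hb : ∀ u, ‖b u‖ ≤ B * ‖u‖) (hA : 0 ≤ A) (hB : 0 ≤ B) (hab : ∀ u, a u =ᵐ[volume] b u) :
    Coupling V where
  form φ := coupling a b (toL6 φ)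
  const := A * B * sobolevConst
  const_nonneg := by positivity
  norm_sub_le φ χ := by
    have h : ∀ u v, (coupling a b (toL6 φ) - coupling a b (toL6 χ)) u v
        = coupling a b (toL6 φ - toL6 χ) u v := fun u v => by
      rw [map_sub]
    refine ContinuousLinearMap.opNorm_le_bound₂ _ (by positivity) fun u v => ?_
    rw [h]
    have h1 := norm_coupling_le a b ha hb hB (toL6 φ - toL6 χ) u v
    have h2 := mul_le_mul_of_nonneg_left (norm_toL6_sub_le φ χ) (mul_nonneg hA hB)
    have h3 := mul_le_mul_of_nonneg_right (mul_le_mul_of_nonneg_right h2 (norm_nonneg u))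
      (norm_nonneg v)
    rw [← mul_assoc] at h3
    exact h1.trans h3
  midpoint φ χ m h u := by
    rw [h, map_add, map_smul, map_smul]
    rfl
  symm φ u v := by
    rw [coupling_apply a b EventuallyEq.rfl (hab u) EventuallyEq.rfl,
      coupling_apply a b EventuallyEq.rfl (hab v) EventuallyEq.rfl]
    congr 1
    ext x
    ring

end MulCoupling

/-! ### The power nonlinearity -/

section Power

/-- The tangent line inequality for the convex function `|·|^(p+1)`. -/
theorem mul_abs_rpow_le {p : ℝ} (hp : 1 ≤ p) (a b : ℝ) :
    (p + 1) * (|a| ^ (p - 1) * a) * (b - a) ≤ |b| ^ (p + 1) - |a| ^ (p + 1) := by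
  have h0 : 0 < p := by linarith
  have hA : |a| ^ (p - 1) * |a| = |a| ^ p := by
    rw [← Real.rpow_add_one' (abs_nonneg a) (by linarith)]
    congr 1
    ring
  have hA1 : |a| ^ p * |a| = |a| ^ (p + 1) :=
    (Real.rpow_add_one' (abs_nonneg a) (by linarith)).symm
  have hY : |a| ^ p * |b| ≤ p / (p + 1) * |a| ^ (p + 1) + 1 / (p + 1) * |b| ^ (p + 1) := by
    have := Real.geom_mean_le_arith_mean2_weighted (w₁ := p / (p + 1)) (w₂ := 1 / (p + 1))
      (p₁ := |a| ^ (p + 1)) (p₂ := |b| ^ (p + 1)) (by positivity) (by positivity) (by positivity)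
      (by positivity) (by field_simp)
    rw [← Real.rpow_mul (abs_nonneg a), ← Real.rpow_mul (abs_nonneg b)] at this
    have e1 : (p + 1) * (p / (p + 1)) = p := by field_simp
    have e2 : (p + 1) * (1 / (p + 1)) = 1 := by field_simp
    rwa [e1, e2, Real.rpow_one] at this
  have h1 : |a| ^ (p - 1) * a * b ≤ |a| ^ p * |b| := by
    rw [← hA, mul_assoc, mul_assoc, ← abs_mul]
    gcongr
    exact le_abs_self _
  have h2 : |a| ^ (p - 1) * a * a = |a| ^ (p + 1) := by
    rw [← hA1, ← hA, mul_assoc, mul_assoc, abs_mul_abs_self]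
  have h3 : (p + 1) * (p / (p + 1) * |a| ^ (p + 1) + 1 / (p + 1) * |b| ^ (p + 1))
      = p * |a| ^ (p + 1) + |b| ^ (p + 1) := by field_simp
  have h4 := mul_le_mul_of_nonneg_left (h1.trans hY) (by linarith : 0 ≤ p + 1)
  rw [h3] at h4
  have e : (p + 1) * (|a| ^ (p - 1) * a) * (b - a)
      = (p + 1) * (|a| ^ (p - 1) * a * b) - (p + 1) * (|a| ^ (p - 1) * a * a) := by ring
  rw [e, h2]
  linarith

/-- The local Lipschitz estimate for the power nonlinearity `t ↦ |t|^(p-1) t`. -/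
theorem abs_rpow_sub_le {p : ℝ} (hp : 1 ≤ p) (a b : ℝ) :
    |(|a| ^ (p - 1) * a) - (|b| ^ (p - 1) * b)| ≤ p * (|a| + |b|) ^ (p - 1) * |a - b| := by
  wlog hab : |b| ≤ |a| generalizing a b
  · rw [abs_sub_comm, add_comm |a|, abs_sub_comm a]
    exact this b a (le_of_not_ge hab)
  wlog ha : 0 ≤ a generalizing a b
  · have := this (-a) (-b) (by simpa using hab) (by linarith)
    simp only [abs_neg] at this
    have e1 : |a| ^ (p - 1) * -a - |b| ^ (p - 1) * -b
        = -(|a| ^ (p - 1) * a - |b| ^ (p - 1) * b) := by ring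
    have e2 : -a - -b = -(a - b) := by ring
    rwa [e1, e2, abs_neg, abs_neg] at this
  rw [abs_of_nonneg ha] at hab ⊢
  have hba := abs_le.1 hab
  have hsub : 0 ≤ a - b := by linarith
  have hpow : ∀ t : ℝ, 0 ≤ t → t ^ (p - 1) * t = t ^ p := fun t ht => by
    rw [← Real.rpow_add_one' ht (by linarith)]
    congr 1
    ring
  have hmono : |b| ^ (p - 1) ≤ a ^ (p - 1) := Real.rpow_le_rpow (abs_nonneg _) hab (by linarith)
  have hk : a ^ (p - 1) ≤ (a + |b|) ^ (p - 1) :=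
    Real.rpow_le_rpow ha (by linarith [abs_nonneg b]) (by linarith)
  have hk0 : 0 ≤ a ^ (p - 1) := by positivity
  have hb0 : 0 ≤ |b| ^ (p - 1) := by positivity
  have hge : 0 ≤ a ^ (p - 1) * a - |b| ^ (p - 1) * b := by
    rcases le_total 0 b with hb | hb <;> nlinarith
  rw [abs_of_nonneg hge, abs_of_nonneg hsub]
  have key : a ^ (p - 1) * a - |b| ^ (p - 1) * b ≤ p * a ^ (p - 1) * (a - b) := by
    rcases le_total 0 b with hb | hb
    · rw [abs_of_nonneg hb]
      rcases ha.eq_or_lt with h0 | h0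
      · have : b = 0 := by rw [← h0, abs_of_nonneg hb] at hab; linarith
        simp [this, ← h0]
      -- Bernoulli's inequality for the ratio `b / a`
      have hB := one_add_mul_self_le_rpow_one_add (s := b / a - 1)
        (by have : 0 ≤ b / a := by positivity
            linarith) hp
      have e : 1 + (b / a - 1) = b / a := by ring
      rw [e, Real.div_rpow hb ha, le_div_iff₀ (by positivity)] at hB
      rw [hpow a ha, hpow b hb]
      have e2 : (1 + p * (b / a - 1)) * a ^ p = a ^ p - p * a ^ (p - 1) * (a - b) := by
        rw [← hpow a ha]
        field_simp
        ring
      rw [e2] at hB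
      linarith
    · have h1 : -(|b| ^ (p - 1) * b) ≤ -(a ^ (p - 1) * b) := by nlinarith
      have h2 : 0 ≤ a ^ (p - 1) * (a - b) := by positivity
      nlinarith
  refine key.trans ?_
  gcongr

variable {α : Type*} [MeasurableSpace α] {μ : Measure α}

/-- Hölder's inequality for `∫ |a|^(p-1) b c` with `a, b, c ∈ L^(p+1)`. -/
theorem lintegral_rpow_mul_mul_le {p : ℝ} (hp : 1 ≤ p) {a b c : α → ℝ}
    (ha : AEStronglyMeasurable a μ) (hb : AEStronglyMeasurable b μ)
    (hc : AEStronglyMeasurable c μ) :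
    ∫⁻ x, ‖|a x| ^ (p - 1) * b x * c x‖ₑ ∂μ
      ≤ eLpNorm a (ENNReal.ofReal (p + 1)) μ ^ (p - 1) * eLpNorm b (ENNReal.ofReal (p + 1)) μ
        * eLpNorm c (ENNReal.ofReal (p + 1)) μ := by
  have h1 : 0 < p + 1 := by linarith
  have hN : ∀ f : α → ℝ, eLpNorm f (ENNReal.ofReal (p + 1)) μ
      = (∫⁻ x, ‖f x‖ₑ ^ (p + 1) ∂μ) ^ (1 / (p + 1)) := fun f => by
    rw [eLpNorm_eq_lintegral_rpow_enorm_toReal (by simpa using h1) ENNReal.ofReal_ne_top,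
      ENNReal.toReal_ofReal h1.le]
  have hH := ENNReal.lintegral_prod_norm_pow_le (μ := μ) (Finset.univ : Finset (Fin 3))
    (f := ![fun x => ‖a x‖ₑ ^ (p + 1), fun x => ‖b x‖ₑ ^ (p + 1), fun x => ‖c x‖ₑ ^ (p + 1)])
    (by
      intro i _
      fin_cases i
      · exact ha.enorm.pow_const _
      · exact hb.enorm.pow_const _
      · exact hc.enorm.pow_const _)
    (p := ![(p - 1) / (p + 1), 1 / (p + 1), 1 / (p + 1)])
    (by simp [Fin.sum_univ_three]; field_simp; ring)
    (by
      intro i _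
      fin_cases i
      · exact div_nonneg (by linarith) h1.le
      · exact one_div_nonneg.2 h1.le
      · exact one_div_nonneg.2 h1.le)
  simp only [Fin.prod_univ_three, Matrix.cons_val_zero, Matrix.cons_val_one,
    Matrix.cons_val] at hH
  have e1 : ∀ t : ℝ≥0∞, (t ^ (p + 1)) ^ (1 / (p + 1)) = t := fun t => by
    rw [← ENNReal.rpow_mul, mul_one_div_cancel h1.ne', ENNReal.rpow_one]
  have e2 : ∀ t : ℝ≥0∞, (t ^ (p + 1)) ^ ((p - 1) / (p + 1)) = t ^ (p - 1) := fun t => by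
    rw [← ENNReal.rpow_mul, mul_div_cancel₀ _ h1.ne']
  have e3 : ∀ t : ℝ≥0∞, t ^ ((p - 1) / (p + 1)) = (t ^ (1 / (p + 1))) ^ (p - 1) := fun t => by
    rw [← ENNReal.rpow_mul]
    congr 1
    ring
  simp only [e1, e2] at hH
  rw [e3, ← hN, ← hN, ← hN] at hH
  refine le_trans (le_of_eq (lintegral_congr fun x => ?_)) hH
  rw [enorm_mul, enorm_mul, Real.enorm_rpow_of_nonneg (abs_nonneg _) (by linarith), Real.enorm_abs]

/-- The `L^(p+1)` norm as a real number. -/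
noncomputable def powNorm (p : ℝ) (μ : Measure α) (f : α → ℝ) : ℝ :=
  (eLpNorm f (ENNReal.ofReal (p + 1)) μ).toReal

theorem powNorm_nonneg (p : ℝ) (f : α → ℝ) : 0 ≤ powNorm p μ f := ENNReal.toReal_nonneg

theorem lintegral_rpow_mul_mul_le_ofReal {p : ℝ} (hp : 1 ≤ p) {a b c : α → ℝ}
    (ha : MemLp a (ENNReal.ofReal (p + 1)) μ) (hb : MemLp b (ENNReal.ofReal (p + 1)) μ)
    (hc : MemLp c (ENNReal.ofReal (p + 1)) μ) :
    ∫⁻ x, ‖|a x| ^ (p - 1) * b x * c x‖ₑ ∂μ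
      ≤ ENNReal.ofReal (powNorm p μ a ^ (p - 1) * powNorm p μ b * powNorm p μ c) := by
  refine (lintegral_rpow_mul_mul_le hp ha.1 hb.1 hc.1).trans (le_of_eq ?_)
  have h0 : ∀ f : α → ℝ, 0 ≤ powNorm p μ f := fun f => powNorm_nonneg p f
  rw [ENNReal.ofReal_mul (mul_nonneg (Real.rpow_nonneg (h0 a) _) (h0 b)),
    ENNReal.ofReal_mul (Real.rpow_nonneg (h0 a) _),
    ← ENNReal.ofReal_rpow_of_nonneg (h0 a) (by linarith)]
  unfold powNorm
  rw [ENNReal.ofReal_toReal ha.2.ne, ENNReal.ofReal_toReal hb.2.ne, ENNReal.ofReal_toReal hc.2.ne]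

theorem integrable_rpow_mul_mul {p : ℝ} (hp : 1 ≤ p) {a b c : α → ℝ}
    (ha : MemLp a (ENNReal.ofReal (p + 1)) μ) (hb : MemLp b (ENNReal.ofReal (p + 1)) μ)
    (hc : MemLp c (ENNReal.ofReal (p + 1)) μ) :
    Integrable (fun x => |a x| ^ (p - 1) * b x * c x) μ := by
  refine ⟨?_, (lintegral_rpow_mul_mul_le_ofReal hp ha hb hc).trans_lt ENNReal.ofReal_lt_top⟩
  have hcont : Continuous fun t : ℝ => |t| ^ (p - 1) :=
    continuous_abs.rpow_const fun _ => Or.inr (by linarith)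
  exact ((hcont.comp_aestronglyMeasurable ha.1).mul hb.1).mul hc.1

theorem integral_norm_rpow_mul_mul_le {p : ℝ} (hp : 1 ≤ p) {a b c : α → ℝ}
    (ha : MemLp a (ENNReal.ofReal (p + 1)) μ) (hb : MemLp b (ENNReal.ofReal (p + 1)) μ)
    (hc : MemLp c (ENNReal.ofReal (p + 1)) μ) :
    ∫ x, ‖|a x| ^ (p - 1) * b x * c x‖ ∂μ
      ≤ powNorm p μ a ^ (p - 1) * powNorm p μ b * powNorm p μ c := by
  rw [integral_norm_eq_lintegral_enorm (integrable_rpow_mul_mul hp ha hb hc).1]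
  refine ENNReal.toReal_le_of_le_ofReal ?_ (lintegral_rpow_mul_mul_le_ofReal hp ha hb hc)
  exact mul_nonneg (mul_nonneg (Real.rpow_nonneg (powNorm_nonneg p a) _) (powNorm_nonneg p b))
    (powNorm_nonneg p c)

/-- The power nonlinearity is locally Lipschitz from `L^(p+1)` to its dual. -/
theorem integral_rpow_sub_le {p : ℝ} (hp : 1 ≤ p) {a b c : α → ℝ}
    (ha : MemLp a (ENNReal.ofReal (p + 1)) μ) (hb : MemLp b (ENNReal.ofReal (p + 1)) μ)
    (hc : MemLp c (ENNReal.ofReal (p + 1)) μ) :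
    |(∫ x, |a x| ^ (p - 1) * a x * c x ∂μ) - ∫ x, |b x| ^ (p - 1) * b x * c x ∂μ|
      ≤ p * (powNorm p μ a + powNorm p μ b) ^ (p - 1) * powNorm p μ (a - b) * powNorm p μ c := by
  have hs : MemLp (fun x => |a x| + |b x|) (ENNReal.ofReal (p + 1)) μ := ha.abs.add hb.abs
  have hi := integrable_rpow_mul_mul hp hs (ha.sub hb) hc
  have hle := integral_norm_rpow_mul_mul_le hp hs (ha.sub hb) hc
  have hn : powNorm p μ (fun x => |a x| + |b x|) ≤ powNorm p μ a + powNorm p μ b := by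
    unfold powNorm
    rw [← ENNReal.toReal_add ha.2.ne hb.2.ne]
    refine ENNReal.toReal_mono (ENNReal.add_ne_top.2 ⟨ha.2.ne, hb.2.ne⟩) ?_
    refine (eLpNorm_add_le ha.abs.1 hb.abs.1 ?_).trans (le_of_eq ?_)
    · rw [← ENNReal.ofReal_one]
      exact ENNReal.ofReal_le_ofReal (by linarith)
    · congr 1
      · exact eLpNorm_norm a
      · exact eLpNorm_norm b
  rw [← integral_sub (integrable_rpow_mul_mul hp ha ha hc) (integrable_rpow_mul_mul hp hb hb hc)]
  calc |∫ x, (|a x| ^ (p - 1) * a x * c x - |b x| ^ (p - 1) * b x * c x) ∂μ|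
      ≤ ∫ x, p * ‖|(|a x| + |b x|)| ^ (p - 1) * (a - b) x * c x‖ ∂μ := by
        rw [← Real.norm_eq_abs]
        refine norm_integral_le_of_norm_le (hi.norm.const_mul p) (Eventually.of_forall fun x => ?_)
        rw [← sub_mul, norm_mul, norm_mul, norm_mul, Real.norm_eq_abs, ← mul_assoc, ← mul_assoc]
        refine mul_le_mul_of_nonneg_right ?_ (norm_nonneg _)
        have h0 : 0 ≤ |a x| + |b x| := by positivity
        rw [abs_of_nonneg h0, Real.norm_of_nonneg (Real.rpow_nonneg h0 _)]
        exact abs_rpow_sub_le hp (a x) (b x)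
    _ = p * ∫ x, ‖|(|a x| + |b x|)| ^ (p - 1) * (a - b) x * c x‖ ∂μ :=
        integral_const_mul p _
    _ ≤ p * ((powNorm p μ a + powNorm p μ b) ^ (p - 1) * powNorm p μ (a - b) * powNorm p μ c) := by
        refine mul_le_mul_of_nonneg_left (hle.trans ?_) (by linarith)
        have h1 : powNorm p μ (fun x => |a x| + |b x|) ^ (p - 1)
            ≤ (powNorm p μ a + powNorm p μ b) ^ (p - 1) :=
          Real.rpow_le_rpow (powNorm_nonneg p _) hn (by linarith)
        exact mul_le_mul_of_nonneg_right
          (mul_le_mul_of_nonneg_right h1 (powNorm_nonneg p _)) (powNorm_nonneg p _)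
    _ = _ := by ring

theorem integrable_abs_rpow {p : ℝ} (hp : 1 ≤ p) {a : α → ℝ}
    (ha : MemLp a (ENNReal.ofReal (p + 1)) μ) : Integrable (fun x => |a x| ^ (p + 1)) μ := by
  have := ha.integrable_norm_rpow (by simp; linarith) ENNReal.ofReal_ne_top
  simpa [ENNReal.toReal_ofReal (by linarith : 0 ≤ p + 1)] using this

theorem integral_abs_rpow_sub_ge {p : ℝ} (hp : 1 ≤ p) {a b : α → ℝ}
    (ha : MemLp a (ENNReal.ofReal (p + 1)) μ) (hb : MemLp b (ENNReal.ofReal (p + 1)) μ) :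
    (p + 1) * ∫ x, |a x| ^ (p - 1) * a x * (b x - a x) ∂μ
      ≤ (∫ x, |b x| ^ (p + 1) ∂μ) - ∫ x, |a x| ^ (p + 1) ∂μ := by
  rw [← integral_const_mul, ← integral_sub (integrable_abs_rpow hp hb) (integrable_abs_rpow hp ha)]
  refine integral_mono ((integrable_rpow_mul_mul hp ha ha (hb.sub ha)).const_mul _)
    ((integrable_abs_rpow hp hb).sub (integrable_abs_rpow hp ha)) fun x => ?_
  have := mul_abs_rpow_le hp (a x) (b x)
  simpa only [mul_assoc] using this

end Power

section PowerEmbedding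

variable {α : Type*} [MeasurableSpace α] {μ : Measure α} {V : Type*} [NormedAddCommGroup V]
  [NormedSpace ℝ V] {p : ℝ}

/-- A bounded linear map from `V` to `L^(p+1)`, given by a choice of representatives. -/
structure PowEmbedding (V : Type*) [NormedAddCommGroup V] [NormedSpace ℝ V] (p : ℝ)
    (μ : Measure α) where
  /-- A representative of the image of a vector. -/
  fn : V → α → ℝ
  /-- A bound for the operator norm. -/
  const : ℝ
  const_nonneg : 0 ≤ const
  memLp : ∀ u, MemLp (fn u) (ENNReal.ofReal (p + 1)) μ
  fn_add : ∀ u v, fn (u + v) =ᵐ[μ] fn u + fn v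
  fn_smul : ∀ (c : ℝ) u, fn (c • u) =ᵐ[μ] c • fn u
  powNorm_le : ∀ u, powNorm p μ (fn u) ≤ const * ‖u‖

theorem PowEmbedding.fn_sub (s : PowEmbedding V p μ) (u v : V) :
    s.fn (u - v) =ᵐ[μ] s.fn u - s.fn v := by
  have h := s.fn_add u ((-1 : ℝ) • v)
  rw [neg_one_smul, ← sub_eq_add_neg] at h
  have h' := s.fn_smul (-1) v
  rw [neg_one_smul] at h'
  filter_upwards [h, h'] with x h1 h2
  rw [h1, Pi.add_apply, h2, Pi.smul_apply, neg_one_smul, Pi.sub_apply, sub_eq_add_neg]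

theorem PowEmbedding.powNorm_sub_le (s : PowEmbedding V p μ) (u v : V) :
    powNorm p μ (s.fn u - s.fn v) ≤ s.const * ‖u - v‖ := by
  refine le_trans (le_of_eq ?_) (s.powNorm_le (u - v))
  unfold powNorm
  rw [eLpNorm_congr_ae (s.fn_sub u v)]

theorem PowEmbedding.integrable (s : PowEmbedding V p μ) (hp : 1 ≤ p) (u v : V) :
    Integrable (fun x => |s.fn u x| ^ (p - 1) * s.fn u x * s.fn v x) μ :=
  integrable_rpow_mul_mul hp (s.memLp u) (s.memLp u) (s.memLp v)

/-- The functional `v ↦ ∫ |u|^(p-1) u v`. -/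
noncomputable def PowEmbedding.form (s : PowEmbedding V p μ) (hp : 1 ≤ p) (u : V) : V →L[ℝ] ℝ :=
  LinearMap.mkContinuous
    { toFun := fun v => ∫ x, |s.fn u x| ^ (p - 1) * s.fn u x * s.fn v x ∂μ
      map_add' := fun v w => by
        rw [← integral_add (s.integrable hp u v) (s.integrable hp u w)]
        refine integral_congr_ae ?_
        filter_upwards [s.fn_add v w] with x hx
        rw [hx, Pi.add_apply, mul_add]
      map_smul' := fun c v => by
        rw [RingHom.id_apply, smul_eq_mul, ← integral_const_mul]
        refine integral_congr_ae ?_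
        filter_upwards [s.fn_smul c v] with x hx
        rw [hx, Pi.smul_apply, smul_eq_mul, mul_left_comm] }
    (powNorm p μ (s.fn u) ^ (p - 1) * powNorm p μ (s.fn u) * s.const) fun v => by
      have h := (norm_integral_le_integral_norm _).trans
        (integral_norm_rpow_mul_mul_le hp (s.memLp u) (s.memLp u) (s.memLp v))
      refine h.trans ?_
      rw [mul_assoc _ s.const]
      exact mul_le_mul_of_nonneg_left (s.powNorm_le v)
        (mul_nonneg (Real.rpow_nonneg (powNorm_nonneg p _) _) (powNorm_nonneg p _))

theorem PowEmbedding.form_apply (s : PowEmbedding V p μ) (hp : 1 ≤ p) (u v : V) :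
    s.form hp u v = ∫ x, |s.fn u x| ^ (p - 1) * s.fn u x * s.fn v x ∂μ := rfl

theorem PowEmbedding.norm_form_sub_le (s : PowEmbedding V p μ) (hp : 1 ≤ p) (u w : V) :
    ‖s.form hp w - s.form hp u‖
      ≤ p * (s.const * ‖w‖ + s.const * ‖u‖) ^ (p - 1) * (s.const * ‖w - u‖) * s.const := by
  have hc := s.const_nonneg
  have h0 : ∀ u, 0 ≤ powNorm p μ (s.fn u) := fun u => powNorm_nonneg p _
  refine ContinuousLinearMap.opNorm_le_bound _ (by positivity) fun v => ?_
  have h := integral_rpow_sub_le hp (s.memLp w) (s.memLp u) (s.memLp v)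
  refine h.trans ?_
  rw [mul_assoc _ s.const]
  have h1 : (powNorm p μ (s.fn w) + powNorm p μ (s.fn u)) ^ (p - 1)
      ≤ (s.const * ‖w‖ + s.const * ‖u‖) ^ (p - 1) :=
    Real.rpow_le_rpow (add_nonneg (h0 w) (h0 u)) (add_le_add (s.powNorm_le w) (s.powNorm_le u))
      (by linarith)
  have hk : 0 ≤ (s.const * ‖w‖ + s.const * ‖u‖) ^ (p - 1) := by positivity
  refine mul_le_mul (mul_le_mul (mul_le_mul_of_nonneg_left h1 (by linarith))
    (s.powNorm_sub_le w u) (powNorm_nonneg p _) (by positivity)) (s.powNorm_le v) (h0 v)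
    (by positivity)

theorem PowEmbedding.continuous_form (s : PowEmbedding V p μ) (hp : 1 ≤ p) :
    Continuous (s.form hp) := by
  refine continuous_iff_continuousAt.2 fun u => ?_
  refine (tendsto_iff_norm_sub_tendsto_zero (E := V →L[ℝ] ℝ)).2 ?_
  refine squeeze_zero (fun w => norm_nonneg (s.form hp w - s.form hp u))
    (fun w => s.norm_form_sub_le hp u w) ?_
  have h1 : Continuous fun w : V => (s.const * ‖w‖ + s.const * ‖u‖) ^ (p - 1) :=
    Continuous.rpow_const (by fun_prop) fun _ => Or.inr (by linarith)
  have hc : Continuous fun w : V =>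
      p * (s.const * ‖w‖ + s.const * ‖u‖) ^ (p - 1) * (s.const * ‖w - u‖) * s.const := by
    fun_prop
  simpa using hc.tendsto u

theorem PowEmbedding.neg_integral_sub_le (s : PowEmbedding V p μ) (hp : 1 ≤ p) (u v : V) :
    -(∫ x, |s.fn v x| ^ (p + 1) ∂μ) - -(∫ x, |s.fn u x| ^ (p + 1) ∂μ)
      ≤ ((-(p + 1)) • s.form hp u) (v - u) + 0 * ‖v - u‖ ^ 2 := by
  have h := integral_abs_rpow_sub_ge hp (s.memLp u) (s.memLp v)
  have e : s.form hp u (v - u) = ∫ x, |s.fn u x| ^ (p - 1) * s.fn u x * (s.fn v x - s.fn u x) ∂μ := by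
    rw [s.form_apply]
    refine integral_congr_ae ?_
    filter_upwards [s.fn_sub v u] with x hx
    rw [hx, Pi.sub_apply]
  rw [smul_apply, e, smul_eq_mul]
  linarith

theorem PowEmbedding.contDiff_neg_integral (s : PowEmbedding V p μ) (hp : 1 ≤ p) :
    ContDiff ℝ 1 fun u => -∫ x, |s.fn u x| ^ (p + 1) ∂μ :=
  contDiff_one_of_le_quadratic ((s.continuous_form hp).const_smul (-(p + 1)))
    (r := fun _ => 0) continuous_const (s.neg_integral_sub_le hp)

theorem PowEmbedding.hasFDerivAt_neg_integral (s : PowEmbedding V p μ) (hp : 1 ≤ p) (u : V) :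
    HasFDerivAt (fun u => -∫ x, |s.fn u x| ^ (p + 1) ∂μ) ((-(p + 1)) • s.form hp u) u :=
  hasFDerivAt_of_le_quadratic ((s.continuous_form hp).const_smul (-(p + 1)))
    (r := fun _ => 0) continuous_const (s.neg_integral_sub_le hp) u

end PowerEmbedding

/-! ### The reduced functional -/

/-- The embedding of `H¹` into `L²`. -/
noncomputable def H1.toL2 : H1 →L[ℝ] Lp ℝ 2 (volume : Measure R3) :=
  (WithLp.fstL 2 ℝ _ _).comp H1.subtypeL

/-- The embedding of `H¹` into `L³`. -/
noncomputable def H1.toL3 : H1 →L[ℝ] Lp ℝ (ENNReal.ofReal 3) (volume : Measure R3) :=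
  H1.toLq 3 (by norm_num) (by norm_num)

theorem H1.coeFn_toL3 (u : H1) : H1.toL3 u =ᵐ[volume] H1.fn u := H1.coeFn_toLq 3 _ _ u

theorem H1.norm_toL2_le (u : H1) : ‖H1.toL2 u‖ ≤ 1 * ‖u‖ := by
  rw [one_mul]
  exact WithLp.norm_fst_le _ u.1

theorem H1.norm_toL3_le (u : H1) : ‖H1.toL3 u‖ ≤ (1 + sobolevConst) * ‖u‖ := by
  refine (Lp.norm_toLp _ (H1.memLp (q := 3) (by norm_num) (by norm_num) u)).trans_le ?_
  exact ENNReal.toReal_le_of_le_ofReal (by positivity) (H1.eLpNorm_le (by norm_num) (by norm_num) u)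

theorem H1.inner_eq (u v : H1) : inner ℝ u v
    = (∫ x, H1.fn u x * H1.fn v x) + ∫ x, inner ℝ (H1.grad u x) (H1.grad v x) := by
  have h1 : ∫ x, H1.fn u x * H1.fn v x = inner ℝ u.1.fst v.1.fst := by
    rw [L2.inner_def]
    refine integral_congr_ae (Eventually.of_forall fun x => ?_)
    simp [H1.fn, mul_comm]
  rw [h1]
  exact WithLp.prod_inner_apply u.1 v.1

theorem H1.norm_sq_eq (u : H1) : ‖u‖ ^ 2 = ∫ x, (‖H1.grad u x‖ ^ 2 + H1.fn u x ^ 2) := by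
  rw [← real_inner_self_eq_norm_sq, H1.inner_eq]
  rw [add_comm, ← integral_add]
  · refine integral_congr_ae (Eventually.of_forall fun x => ?_)
    simp only [real_inner_self_eq_norm_sq, pow_two]
  · exact L2.integrable_inner u.1.snd u.1.snd
  · exact MemLp.integrable_mul (H1.memLp_fn u) (H1.memLp_fn u)

/-- The coupling `(u, v) ↦ ∫ φ u v` on `H¹`. -/
noncomputable def H1.coupling : Coupling H1 :=
  mulCoupling H1.toL3 H1.toL2 H1.norm_toL3_le H1.norm_toL2_le (by positivity) zero_le_one
    H1.coeFn_toL3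

theorem H1.coupling_form_apply (φ : X) (u v : H1) :
    H1.coupling.form φ u v = ∫ x, φ.1 x * H1.fn u x * H1.fn v x :=
  coupling_apply H1.toL3 H1.toL2 (coeFn_toL6 φ) (H1.coeFn_toL3 u) EventuallyEq.rfl

/-- The Sobolev embedding of `H¹` into `L^(p+1)`. -/
noncomputable def H1.powEmbedding (p : ℝ) (hp1 : 1 ≤ p) (hp5 : p ≤ 5) :
    PowEmbedding H1 p (volume : Measure R3) where
  fn := H1.fn
  const := 1 + sobolevConst
  const_nonneg := by positivity
  memLp u := H1.memLp (by linarith) (by linarith) u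
  fn_add := H1.fn_add
  fn_smul := H1.fn_smul
  powNorm_le u := ENNReal.toReal_le_of_le_ofReal (by positivity)
    (H1.eLpNorm_le (by linarith) (by linarith) u)

theorem H1.integrable_mul_mul (φ : X) (u v : H1) :
    Integrable fun x => φ.1 x * H1.fn u x * H1.fn v x :=
  BornInfeld.integrable_mul_mul (X_memLp_six φ.2) (H1.memLp (by norm_num) (by norm_num) u)
    (H1.memLp_fn v)

theorem E_eq_action (u : H1) (φ : X) : E u φ.1 = action H1.coupling u φ := by
  unfold E action energy density
  rw [H1.coupling_form_apply]
  congr 2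
  ext x
  ring

theorem isMinimizer_iff (u : H1) (φ : X) :
    IsMinimizer u φ.1 ↔ ∀ χ, action H1.coupling u φ ≤ action H1.coupling u χ := by
  constructor
  · intro h χ
    rw [← E_eq_action, ← E_eq_action]
    exact h.2 χ.1 χ.2
  · intro h
    refine ⟨φ.2, fun χ hχ => ?_⟩
    have := h ⟨χ, hχ⟩
    rwa [← E_eq_action, ← E_eq_action] at this

theorem isMinimizer_phi (u : H1) : IsMinimizer u (phi u) := by
  obtain ⟨φ, hφ⟩ := exists_action_minimizer H1.coupling u
  exact Classical.epsilon_spec (p := IsMinimizer u) ⟨φ.1, (isMinimizer_iff u φ).2 hφ⟩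

theorem eq_phi_of_isMinimizer {u : H1} {χ : R3 → ℝ} (h : IsMinimizer u χ) : χ = phi u := by
  have h1 := (isMinimizer_iff u ⟨phi u, (isMinimizer_phi u).1⟩).1 (isMinimizer_phi u)
  have h2 := (isMinimizer_iff u ⟨χ, h.1⟩).1 h
  exact congrArg Subtype.val (action_minimizer_unique h1 h2)

/-- The minimizer `phi u` as an element of `𝒳`. -/
noncomputable def phiX (u : H1) : X := ⟨phi u, (isMinimizer_phi u).1⟩

theorem phiX_le (u : H1) (χ : X) :
    action H1.coupling u (phiX u) ≤ action H1.coupling u χ :=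
  (isMinimizer_iff u (phiX u)).1 (isMinimizer_phi u) χ

theorem integral_sq_eq (φ : X) (u : H1) :
    ∫ x, φ.1 x * H1.fn u x ^ 2 = H1.coupling.form φ u u := by
  rw [H1.coupling_form_apply]
  congr 1
  ext x
  ring

/-- The reduced functional is `½ ‖u‖²`, minus half the minimal value of `E(u, ·)`, minus the power
term. -/
theorem I_eq (p : ℝ) : I p = fun u : H1 => 1 / 2 * ‖u‖ ^ 2
    + -(1 / 2) * action H1.coupling u (phiX u)
    + 1 / (p + 1) * -∫ x, |H1.fn u x| ^ (p + 1) := by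
  funext u
  have h1 : ∫ x, phi u x * H1.fn u x ^ 2 = H1.coupling.form (phiX u) u u :=
    integral_sq_eq (phiX u) u
  have h2 : ∫ x, (1 - √(1 - ‖∇ (phi u) x‖ ^ 2)) = energy (phiX u) := rfl
  have key : ∀ {A A' B B' C D D' : ℝ}, A = A' → B = B' → D = D' →
      1 / 2 * A + 1 / 2 * B - 1 / (p + 1) * C - 1 / 2 * D
        = 1 / 2 * A' + -(1 / 2) * (D' - B') + 1 / (p + 1) * -C := by
    rintro A _ B _ C D _ rfl rfl rfl
    ring
  exact key (H1.norm_sq_eq u).symm h1 h2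

section Sum

variable {V : Type*} [NormedAddCommGroup V] [InnerProductSpace ℝ V] {f g : V → ℝ}

theorem contDiff_half_norm_sq_add (hf : ContDiff ℝ 1 f) (hg : ContDiff ℝ 1 g) (a b : ℝ) :
    ContDiff ℝ 1 fun u => 1 / 2 * ‖u‖ ^ 2 + a * f u + b * g u :=
  ((contDiff_const.mul (contDiff_norm_sq ℝ)).add (contDiff_const.mul hf)).add
    (contDiff_const.mul hg)

theorem fderiv_half_norm_sq_add {L M : V →L[ℝ] ℝ} {u : V} (hf : HasFDerivAt f L u)
    (hg : HasFDerivAt g M u) (a b : ℝ) (v : V) :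
    fderiv ℝ (fun u => 1 / 2 * ‖u‖ ^ 2 + a * f u + b * g u) u v
      = inner ℝ u v + a * L v + b * M v := by
  have h1 : HasFDerivAt (fun u : V => ‖u‖ ^ 2) (2 • innerSL ℝ u) u :=
    (hasStrictFDerivAt_norm_sq u).hasFDerivAt
  have h := (((h1.const_mul (1 / 2)).add (hf.const_mul a)).add (hg.const_mul b)).fderiv
  refine (congrArg (fun L => L v) h).trans ?_
  simp

end Sum

theorem contDiff_I {p : ℝ} (hp1 : 1 ≤ p) (hp5 : p ≤ 5) : ContDiff ℝ 1 (I p) := by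
  rw [I_eq]
  exact contDiff_half_norm_sq_add (contDiff_action_minimizer phiX_le)
    ((H1.powEmbedding p hp1 hp5).contDiff_neg_integral hp1) _ _

theorem fderiv_I {p : ℝ} (hp1 : 1 ≤ p) (hp5 : p ≤ 5) (u v : H1) :
    fderiv ℝ (I p) u v =
      (∫ x, inner ℝ (H1.grad u x) (H1.grad v x)) + (∫ x, H1.fn u x * H1.fn v x)
        + (∫ x, phi u x * H1.fn u x * H1.fn v x)
        - ∫ x, |H1.fn u x| ^ (p - 1) * H1.fn u x * H1.fn v x := by
  have e1 : H1.coupling.form (phiX u) u v = ∫ x, phi u x * H1.fn u x * H1.fn v x :=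
    H1.coupling_form_apply (phiX u) u v
  have e2 : (H1.powEmbedding p hp1 hp5).form hp1 u v
      = ∫ x, |H1.fn u x| ^ (p - 1) * H1.fn u x * H1.fn v x := rfl
  have e3 : fderiv ℝ (I p) u v = inner ℝ u v
      + -(1 / 2) * (-2 * H1.coupling.form (phiX u) u v)
      + 1 / (p + 1) * (-(p + 1) * (H1.powEmbedding p hp1 hp5).form hp1 u v) := by
    have h := fderiv_half_norm_sq_add (hasFDerivAt_action_minimizer phiX_le u)
      ((H1.powEmbedding p hp1 hp5).hasFDerivAt_neg_integral hp1 u) (-(1 / 2)) (1 / (p + 1)) v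
    exact (congrArg (fun f => fderiv ℝ f u v) (I_eq p)).trans h
  have key : ∀ {d i A P a b c e : ℝ}, d = i + -(1 / 2) * (-2 * A) + 1 / (p + 1) * (-(p + 1) * P) →
      A = c → P = e → i = b + a → d = a + b + c - e := by
    rintro d i A P a b c e rfl rfl rfl rfl
    have hp : p + 1 ≠ 0 := by linarith
    field_simp
    ring
  exact key e3 e1 e2 (H1.inner_eq u v)

end BornInfeld

open BornInfeld

theorem proposition2p3 (p : ℝ) (hp1 : 1 ≤ p) (hp5 : p ≤ 5) :
    -- the integrals in `E` and `F` are finite on `H¹ × 𝒳`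
    (∀ u : H1, Integrable (fun x => ‖H1.grad u x‖ ^ 2 + H1.fn u x ^ 2) ∧
      Integrable (fun x => |H1.fn u x| ^ (p + 1)) ∧
      ∀ φ ∈ X, Integrable (fun x => 1 - √(1 - ‖∇ φ x‖ ^ 2)) ∧
        Integrable (fun x => φ x * H1.fn u x ^ 2)) ∧
    -- `phi u` is the unique minimizer of `E(u, ·)` on `𝒳`
    (∀ u : H1, IsMinimizer u (phi u) ∧
      ∀ χ, IsMinimizer u χ → χ = phi u) ∧
    -- the reduced functional is of class `C¹`, and its derivative is as claimed
    ContDiff ℝ 1 (I p) ∧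
    ∀ u v : H1,
      Integrable (fun x => inner ℝ (H1.grad u x) (H1.grad v x)) ∧
      Integrable (fun x => H1.fn u x * H1.fn v x) ∧
      Integrable (fun x => phi u x * H1.fn u x * H1.fn v x) ∧
      Integrable (fun x => |H1.fn u x| ^ (p - 1) * H1.fn u x * H1.fn v x) ∧
      fderiv ℝ (I p) u v =
        (∫ x, inner ℝ (H1.grad u x) (H1.grad v x)) + (∫ x, H1.fn u x * H1.fn v x)
          + (∫ x, phi u x * H1.fn u x * H1.fn v x)
          - ∫ x, |H1.fn u x| ^ (p - 1) * H1.fn u x * H1.fn v x := by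
  refine ⟨fun u => ⟨?_, ?_, fun φ hφ => ⟨X_integrable_density hφ, ?_⟩⟩,
    fun u => ⟨isMinimizer_phi u, fun χ h => eq_phi_of_isMinimizer h⟩, contDiff_I hp1 hp5,
    fun u v => ⟨?_, ?_, H1.integrable_mul_mul (phiX u) u v,
      (H1.powEmbedding p hp1 hp5).integrable hp1 u v, fderiv_I hp1 hp5 u v⟩⟩
  · exact ((H1.memLp_grad u).integrable_norm_pow two_ne_zero).add (H1.memLp_fn u).integrable_sq
  · exact integrable_abs_rpow hp1 (H1.memLp (by linarith) (by linarith) u)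
  · refine (H1.integrable_mul_mul ⟨φ, hφ⟩ u u).congr (Eventually.of_forall fun x => ?_)
    change φ x * H1.fn u x * H1.fn u x = φ x * H1.fn u x ^ 2
    ring
  · exact L2.integrable_inner u.1.snd v.1.snd
  · exact MemLp.integrable_mul (H1.memLp_fn u) (H1.memLp_fn v)
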